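/- **Model.** Let $\lambda,\lambda^+,\lambda^->0$. The mid-price (in ticks) is the compound Poisson process $p(t)=p(0)+\sum_{i=1}^{\mathcal N(t)}X_i$ with $p(0)\in\mathbb Z$, where $\mathcal N$ is a Poisson process of rate $\lambda$ and the $X_i$ are i.i.d., equal to $\pm1$ with probability $\tfrac12$ each. The best ask and best bid at time $t$ are $p(t)+0.5$ and $p(t)-0.5$. Let $\mathcal E^+,\mathcal E^-$ be exponential random variables with rates $\lambda^+,\lambda^-$; $\mathcal N$, $(X_i)$, $\mathcal E^+$, $\mathcal E^-$ are independent. Write $\Delta p[a,b]=p(b)-p(a)$ and $\overline{\mathbb Z}=\mathbb Z\cup\{\pm\infty\}$. **Orders.** An ask order ($+$) with relative price $x\in\overline{\mathbb Z}$, sent at time $0$, has limit price $p(0)+0.5+x$; a bid order ($-$) has limit price $p(0)-0.5-x$. The order reaches the exchange at time $t_1'$. An ask order is filled before time $t_1'+t_2'$ if (1) its limit price is at most the best bid at time $t_1'$ (immediate execution), or (2a) at some time in $[t_1',t_1'+t_2')$ the best bid jumps up across its limit price, or (2b) the total time in $[t_1',t_1'+t_2')$ during which its limit price is the best ask exceeds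 $\mathcal E^+$. Bid orders are treated symmetrically, with $\mathcal E^-$. Let $\mathbb 1_{fill^\pm_{t_1',t_2',x}}$ be the indicator of this event (for $x=+\infty$ the order is almost surely never filled; for $x=-\infty$ it is a market order, filled on arrival). The value of the order is $$H^\pm(t_1',t_2',x)=E\Big[\big(\max\{0.5+x\mp\Delta p[0,t_1'],-0.5\}\mp\Delta p[t_1',t_1'+t_2']\big)\,\mathbb 1_{fill^\pm_{t_1',t_2',x}}\Big],$$ with the convention $\infty\cdot 0=0$. **Theorem.** For all $t_1'\ge0$ and $t_2'>0$, and for each of the two signs, the expectations below exist and the following hold. (a) For every $\delta\in\overline{\mathbb Z}$, $$H^\pm(0,t_2',\delta)=\begin{cases}\Big(\dfrac{\lambda^\pm}{\lambda^\pm+\lambda/2}-0.5\Big)\,E\big[\mathbb 1_{fill^\pm_{0,t_2',\delta}}\big],&\delta\ge0,\\[2mm]-0.5,&\delta<0.\end{cases}$$ (b) For every $\delta\in\overline{\mathbb Z}$, $$H^\pm(t_1',t_2',\delta)=E\big[H^\pm\big(0,t_2',\delta\mp\Delta p[0,t_1']\big)\big].$$ (c) $H^\pm(t_1',t_2',\delta)\le0$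 for every $\delta\in\overline{\mathbb Z}$ if and only if $\lambda^\pm\le\lambda/2$. -/

import Mathlib

open MeasureTheory ProbabilityTheory
open scoped NNReal ENNReal

/-- The extended integers `ℤ ∪ {-∞, +∞}`, with `⊥ = -∞` and `⊤ = +∞`. -/
abbrev ExtInt : Type := WithBot (WithTop ℤ)

/-- The inclusion of the integers into the extended integers. -/
def ExtInt.ofInt (n : ℤ) : ExtInt := ((n : WithTop ℤ) : WithBot (WithTop ℤ))

/-- The side of an order: `ask` is the sign `+` and `bid` is the sign `-`. -/
inductive Side : Type
  | ask
  | bid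

/-- The sign `±1` of a side. -/
def Side.sgn : Side → ℤ
  | .ask => 1
  | .bid => -1

section Model

variable {Ω : Type*} [MeasurableSpace Ω]

/-- `N` is a (homogeneous) Poisson process with rate `lam`: a counting process with
nondecreasing, right-continuous paths started at `0`, with independent increments, whose increment
over `[s, t]` has the Poisson law with mean `lam * (t - s)`. -/
structure IsPoissonProcess (lam : ℝ≥0) (N : ℝ≥0 → Ω → ℕ) (P : Measure Ω) : Prop where
  measurable : ∀ t, Measurable (N t)
  start : ∀ ω, N 0 ω = 0
  mono : ∀ ω, Monotone fun t => N t ω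
  rightCont : ∀ ω t, ContinuousWithinAt (fun u => N u ω) (Set.Ici t) t
  indepIncrements : HasIndepIncrements N P
  law_increment : ∀ s t, s ≤ t →
    HasLaw (fun ω => N t ω - N s ω) (poissonMeasure (lam * (t - s))) P

/-- The probabilistic primitives of the market:
* `N` is a Poisson process with rate `lam` (the times of the mid-price changes);
* `X 0, X 1, …` are i.i.d. price changes, equal to `+1` or `-1` with probability `1/2` each;
* `E .ask` and `E .bid` are the exponential clocks, with rates `hitRate .ask` and `hitRate .bid`,
  of the uninformed order flow hitting the ask order and the bid order respectively;
* `N`, the sequence `X`, `E .ask` and `E .bid` are mutually independent. -/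
structure IsMarketModel (lam : ℝ≥0) (hitRate : Side → ℝ≥0) (N : ℝ≥0 → Ω → ℕ) (X : ℕ → Ω → ℤ)
    (E : Side → Ω → ℝ) (P : Measure Ω) : Prop where
  poisson : IsPoissonProcess lam N P
  measurable_jump : ∀ i, Measurable (X i)
  jump_up : ∀ i, P {ω | X i ω = 1} = 1 / 2
  jump_down : ∀ i, P {ω | X i ω = -1} = 1 / 2
  indep_jumps : iIndepFun X P
  measurable_clock : ∀ side, Measurable (E side)
  law_clock : ∀ side, HasLaw (E side) (expMeasure (hitRate side : ℝ)) P
  indep_clocks : iIndepFun E P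
  indep_count_jumps : IndepFun (fun ω t => N t ω) (fun ω i => X i ω) P
  indep_price_clocks :
    IndepFun (fun ω => ((fun t => N t ω, fun i => X i ω) : (ℝ≥0 → ℕ) × (ℕ → ℤ)))
      (fun ω side => E side ω) P

/-- The compound Poisson mid-price `p(t) = p(0) + ∑_{i = 1}^{N(t)} X_i` (in ticks). -/
def midPrice (p₀ : ℤ) (N : ℝ≥0 → Ω → ℕ) (X : ℕ → Ω → ℤ) (t : ℝ≥0) (ω : Ω) : ℤ :=
  p₀ + ∑ i ∈ Finset.range (N t ω), X i ω

/-- The change `Δp[a, b] = p(b) - p(a)` of the mid-price. -/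
def priceChange (p : ℝ≥0 → Ω → ℤ) (a b : ℝ≥0) (ω : Ω) : ℤ := p b ω - p a ω

/-- The relative price at time `s`, namely `x ∓ Δp[0, s]`, of an order whose relative price at time
`0` is `x`.

An ask order has the limit price `p(0) + 1/2 + x`; the best bid and the best ask at time `s` are
`p(s) - 1/2` and `p(s) + 1/2`. So the limit price is the best ask at time `s` iff the relative price
at time `s` is `0`, and it is at most the best bid iff the relative price is negative. A bid order
has the limit price `p(0) - 1/2 - x`; its relative price at time `s` is `0` iff the limit price is
the best bid at time `s`, and negative iff the limit price is at least the best ask. -/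
def relPrice (p : ℝ≥0 → Ω → ℤ) (side : Side) (x : ExtInt) (s : ℝ≥0) (ω : Ω) : ExtInt :=
  x + ExtInt.ofInt (-(side.sgn * priceChange p 0 s ω))

/-- The order with relative price `x` sent at time `0`, which arrives at the exchange at time `t₁`,
is filled before time `t₁ + t₂`: either it is marketable on arrival; or, while it rests in the book,
the opposite best quote moves through its limit price (as the price moves by single ticks, it does so
by a jump that occurs while the order is at the best quote); or the total time that it spends at the
best quote exceeds its exponential clock. -/
def Filled (p : ℝ≥0 → Ω → ℤ) (E : Side → Ω → ℝ) (side : Side) (t₁ t₂ : ℝ≥0) (x : ExtInt) (ω : Ω) :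
    Prop :=
  relPrice p side x t₁ ω < 0 ∨
  (∃ s ∈ Set.Ico t₁ (t₁ + t₂), relPrice p side x s ω < 0) ∨
  E side ω < (volume {s : ℝ | s ∈ Set.Ico (t₁ : ℝ) ((t₁ : ℝ) + (t₂ : ℝ)) ∧
    relPrice p side x s.toNNReal ω = 0}).toReal

/-- The event that the order is filled. -/
def fillEvent (p : ℝ≥0 → Ω → ℤ) (E : Side → Ω → ℝ) (side : Side) (t₁ t₂ : ℝ≥0) (x : ExtInt) :
    Set Ω :=
  {ω | Filled p E side t₁ t₂ x ω}

/-- `max {1/2 + r, -1/2}` for an extended integer `r`. At `r = +∞` it is only ever multiplied by a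
fill indicator that vanishes almost surely; the value `0` there implements `∞ * 0 = 0`. -/
noncomputable def executionGap : ExtInt → ℝ
  | ⊥ => -(1 / 2)
  | ⊤ => 0
  | ((n : ℤ) : WithTop ℤ) => max (1 / 2 + (n : ℝ)) (-(1 / 2))

/-- The profit `(max {1/2 + x ∓ Δp[0, t₁], -1/2} ∓ Δp[t₁, t₁ + t₂]) * 1_fill` of an order with
relative price `x`, with respect to the mid-price at time `t₁ + t₂`. -/
noncomputable def orderProfit (p : ℝ≥0 → Ω → ℤ) (E : Side → Ω → ℝ) (side : Side) (t₁ t₂ : ℝ≥0)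
    (x : ExtInt) (ω : Ω) : ℝ :=
  (fillEvent p E side t₁ t₂ x).indicator
    (fun ω => executionGap (relPrice p side x t₁ ω)
      - ((side.sgn * priceChange p t₁ (t₁ + t₂) ω : ℤ) : ℝ)) ω

/-- The order value `H^±(t₁, t₂, x)`: the expected profit of the order. -/
noncomputable def orderValue (p : ℝ≥0 → Ω → ℤ) (E : Side → Ω → ℝ) (P : Measure Ω) (side : Side)
    (t₁ t₂ : ℝ≥0) (x : ExtInt) : ℝ :=
  ∫ ω, orderProfit p E side t₁ t₂ x ω ∂P

/-- The fill probability `E[1_fill]`. -/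
noncomputable def fillProb (p : ℝ≥0 → Ω → ℤ) (E : Side → Ω → ℝ) (P : Measure Ω) (side : Side)
    (t₁ t₂ : ℝ≥0) (x : ExtInt) : ℝ :=
  ∫ ω, (fillEvent p E side t₁ t₂ x).indicator (fun _ => (1 : ℝ)) ω ∂P

end Model

/-! Let `Z` be the relative price of the order: a compound Poisson walk with fair unit jumps, the
same for both sides up to the sign of the jumps. For an integer relative price the order is unfilled
exactly when `Z` stays nonnegative on the window and its time at `0` does not exceed the clock.
Integrating out the exponential clock of rate `r` replaces the second condition by the discount `exp
(-r * zeroTime)`, so `unfilledValue` is the semigroup of `Z` killed below `0` and killed at rate `r`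
while at `0`.

On the fill event the profit is the execution gap at arrival plus the later increment of `Z`; on the
unfilled event these two terms add up to `Z + 1/2` at the end. As increments are centred, the value
is the mean gap minus the killed semigroup applied to `k + 1/2` (`orderValue_ofInt`).

For (a), the function `k + c` with `c * r = (1 - c) * lam / 2` is harmonic for the killed generator:
it is affine away from `0`, and at `0` the generator gives `lam / 2 - c * lam / 2 - c * r = 0`.
Hence its unfilled value is `x + c` (`unfilledValue_add_const`). Writing `1/2 = c + (1/2 - c)`
leaves `(1/2 - c)` times the fill probability, and `1 - c = r / (r + lam / 2)`.

The continuous-time facts are obtained from uniform grids: the killed walk on a grid is an iterate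
of the operator `killedStep`, the grid functionals converge path by path because paths are
right-constant, and harmonicity holds up to an error quadratic in the mesh. Letting the same grid
expressions converge for a general arrival time gives the Markov property behind (b).

For (c), (a) and (b) give the sign when `r ≤ lam / 2`. Otherwise, if no order had positive value,
the lower tails of the price change before arrival would decay at most geometrically, against the
super-exponential tails of a compound Poisson sum (`exists_orderValue_pos`). -/

/-! ### Compound Poisson sums: stationary and independent increments. -/

/-- A Poisson process `N` together with an independent sequence of i.i.d. fair `±1` jumps `Y`. -/
structure IsFairCompound {Ω : Type*} [MeasurableSpace Ω] (lam : ℝ≥0) (N : ℝ≥0 → Ω → ℕ)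
    (Y : ℕ → Ω → ℤ) (P : Measure Ω) : Prop where
  poisson : IsPoissonProcess lam N P
  measurable_jump : ∀ i, Measurable (Y i)
  jump_up : ∀ i, P {ω | Y i ω = 1} = 1 / 2
  jump_down : ∀ i, P {ω | Y i ω = -1} = 1 / 2
  indep_jumps : iIndepFun Y P
  indep_count_jumps : IndepFun (fun ω t => N t ω) (fun ω i => Y i ω) P

/-- The partial sums of a sequence of integers. -/
def partialSum (y : ℕ → ℤ) (n : ℕ) : ℤ := ∑ i ∈ Finset.range n, y i

/-- The compound sum of the first `N t` jumps. -/
def compoundSum {Ω : Type*} (N : ℝ≥0 → Ω → ℕ) (Y : ℕ → Ω → ℤ) (t : ℝ≥0) (ω : Ω) : ℤ :=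
  partialSum (fun i => Y i ω) (N t ω)

lemma measurable_partialSum : Measurable fun q : ℕ × (ℕ → ℤ) => partialSum q.2 q.1 := by
  refine measurable_from_prod_countable_right fun n => ?_
  exact Finset.measurable_sum (f := fun i (y : ℕ → ℤ) => y i) (Finset.range n)
    fun i _ => measurable_pi_apply i

lemma measurable_partialSum_coord (u : ℝ≥0) :
    Measurable fun q : (ℝ≥0 → ℕ) × (ℕ → ℤ) => partialSum q.2 (q.1 u) := by
  have h : Measurable fun q : (ℝ≥0 → ℕ) × (ℕ → ℤ) => (q.1 u, q.2) := by fun_prop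
  exact measurable_partialSum.comp h

section

set_option linter.unusedSectionVars false

variable {Ω : Type*} [MeasurableSpace Ω] {P : Measure Ω} [IsProbabilityMeasure P]

/-- Fubini for the product law. It serves to freeze the count path and let only the jumps be random.
-/
lemma IndepFun.measure_mem_eq_lintegral {α β : Type*} [MeasurableSpace α] [MeasurableSpace β]
    {U : Ω → α} {V : Ω → β} (hU : Measurable U) (hV : Measurable V) (h : IndepFun U V P)
    {B : Set (α × β)} (hB : MeasurableSet B) :
    P {ω | (U ω, V ω) ∈ B} = ∫⁻ ω, P {ω' | (U ω, V ω') ∈ B} ∂P := by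
  have h1 : P {ω | (U ω, V ω) ∈ B} = P.map (fun ω => (U ω, V ω)) B := by
    rw [Measure.map_apply (hU.prodMk hV) hB]; rfl
  rw [h1, h.map_prod_eq_prod_map_map hU.aemeasurable hV.aemeasurable,
    Measure.prod_apply hB, lintegral_map (measurable_measure_prodMk_left hB) hU]
  refine lintegral_congr fun ω => ?_
  rw [Measure.map_apply hV (measurable_prodMk_left hB)]
  rfl

/-- Since the process starts at `0`, its values at earlier times are sums of earlier increments,
which are independent of the next one. -/
lemma IsPoissonProcess.indepFun_past {lam : ℝ≥0} {N : ℝ≥0 → Ω → ℕ}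
    (hN : IsPoissonProcess lam N P) {t : ℕ → ℝ≥0} (ht : Monotone t) (m : ℕ) :
    IndepFun (fun ω (i : Finset.range (m + 1)) => N (t i) ω)
      (fun ω => N (t (m + 1)) ω - N (t m) ω) P := by
  -- Prepending time `0` gives `s (i + 1) = t i`, so that the value at `t i` is the sum of the first
  -- `i + 1` increments along `s`.
  let s : ℕ → ℝ≥0 := fun k => Nat.casesOn k 0 t
  have hs : Monotone s := by
    refine monotone_nat_of_le_succ fun n => ?_
    cases n with
    | zero => exact zero_le
    | succ n => exact ht n.le_succ
  have hmeas : ∀ i, Measurable (fun ω => N (s (i + 1)) ω - N (s i) ω) := fun i =>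
    (hN.measurable _).sub (hN.measurable _)
  have h := (hN.indepIncrements.nat hs).indepFun_finset (Finset.range (m + 1)) {m + 1}
    (by simp) hmeas
  have hsum : ∀ i ω, ∑ j ∈ Finset.range i, (N (s (j + 1)) ω - N (s j) ω) = N (s i) ω := by
    intro i ω
    induction i with
    | zero => simp [s, hN.start]
    | succ i ih =>
      rw [Finset.sum_range_succ, ih]
      have := hN.mono ω (hs i.le_succ)
      simp only [Nat.succ_eq_add_one] at this
      omega
  let φ : (Finset.range (m + 1) → ℕ) → (Finset.range (m + 1) → ℕ) := fun d i =>
    ∑ j : Finset.range (m + 1), if (j : ℕ) ≤ i then d j else 0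
  let ψ : (({m + 1} : Finset ℕ) → ℕ) → ℕ := fun d => d ⟨m + 1, by simp⟩
  have h2 := h.comp (φ := φ) (ψ := ψ) (.of_discrete) (.of_discrete)
  convert! h2 using 1
  · ext ω i
    have hi : (i : ℕ) < m + 1 := Finset.mem_range.1 i.2
    simp only [φ, Function.comp]
    rw [Finset.sum_coe_sort (Finset.range (m + 1))
      (fun j => if j ≤ (i : ℕ) then N (s (j + 1)) ω - N (s j) ω else 0), ← Finset.sum_filter]
    have : (Finset.range (m + 1)).filter (fun j => j ≤ (i : ℕ)) = Finset.range (i + 1) := by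
      ext j; simp; omega
    rw [this, hsum]

namespace IsFairCompound

variable {lam : ℝ≥0} {N : ℝ≥0 → Ω → ℕ} {Y : ℕ → Ω → ℤ}

lemma ae_jump (h : IsFairCompound lam N Y P) (i : ℕ) : ∀ᵐ ω ∂P, Y i ω = 1 ∨ Y i ω = -1 := by
  have hm := h.measurable_jump i
  have hd : Disjoint {ω | Y i ω = 1} {ω | Y i ω = -1} := by
    rw [Set.disjoint_left]; intro ω h1 h2; simp only [Set.mem_ofPred_eq] at h1 h2; omega
  have h1 := measure_union (μ := P) hd (hm (measurableSet_singleton (-1)))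
  rw [h.jump_up, h.jump_down, ENNReal.add_halves] at h1
  have := (prob_compl_eq_zero_iff ((hm (measurableSet_singleton 1)).union
    (hm (measurableSet_singleton (-1))))).2 h1
  exact this

lemma identDistrib_jump (h : IsFairCompound lam N Y P) (i j : ℕ) :
    IdentDistrib (Y i) (Y j) P P := by
  refine ⟨(h.measurable_jump i).aemeasurable, (h.measurable_jump j).aemeasurable, ?_⟩
  have key : ∀ i, P.map (Y i) = (1 / 2 : ℝ≥0∞) • Measure.dirac 1 + (1 / 2 : ℝ≥0∞) • Measure.dirac (-1) := by
    intro i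
    have hm := h.measurable_jump i
    have hae := h.ae_jump i
    refine Measure.ext_of_singleton fun k => ?_
    rw [Measure.map_apply hm (measurableSet_singleton k)]
    by_cases h1 : k = 1
    · subst h1; simpa using (show P (Y i ⁻¹' {1}) = 1 / 2 from h.jump_up i)
    by_cases h2 : k = -1
    · subst h2; simpa using (show P (Y i ⁻¹' {-1}) = 1 / 2 from h.jump_down i)
    · have : P (Y i ⁻¹' {k}) = 0 := by
        refine measure_mono_null ?_ hae
        intro ω hω
        simp only [Set.mem_preimage, Set.mem_singleton_iff] at hω
        simp [hω, h1, h2]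
      rw [this]
      simp [Ne.symm h1, Ne.symm h2]
  rw [key, key]

/-- A shifted i.i.d. sequence has the law of the original one. -/
lemma measure_partialSum_sub (h : IsFairCompound lam N Y P) {a b : ℕ} (hab : a ≤ b) {A : Set ℤ} :
    P {ω | partialSum (fun i => Y i ω) b - partialSum (fun i => Y i ω) a ∈ A} =
      P {ω | partialSum (fun i => Y i ω) (b - a) ∈ A} := by
  have h1 : IdentDistrib (fun ω (i : ℕ) => Y (a + i) ω) (fun ω (i : ℕ) => Y i ω) P P :=
    IdentDistrib.pi (fun i => h.identDistrib_jump _ _)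
      (h.indep_jumps.precomp (add_right_injective a)) h.indep_jumps
  have h2 : Measurable fun y : ℕ → ℤ => partialSum y (b - a) := by unfold partialSum; fun_prop
  have h3 := (h1.comp h2).measure_mem_eq (s := A) (MeasurableSet.of_discrete)
  convert! h3 using 2
  ext ω
  simp only [Set.mem_ofPred_eq, partialSum, Set.mem_preimage, Function.comp]
  obtain ⟨c, rfl⟩ := Nat.exists_eq_add_of_le hab
  rw [Finset.sum_range_add]
  simp

/-- The two sides depend on disjoint blocks of jumps. The indices `n i` play the role of a frozen
count path at past times. -/
lemma indepFun_partialSum (h : IsFairCompound lam N Y P) {ι : Type*} (n : ι → ℕ) {a b : ℕ}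
    (hn : ∀ i, n i ≤ a) (hab : a ≤ b) :
    IndepFun (fun ω i => partialSum (fun j => Y j ω) (n i))
      (fun ω => partialSum (fun i => Y i ω) b - partialSum (fun i => Y i ω) a) P := by
  have h1 := h.indep_jumps.indepFun_finset (Finset.range a) (Finset.Ico a b)
    (by rw [Finset.disjoint_left]; intro i; simp; omega) h.measurable_jump
  let φ : (Finset.range a → ℤ) → (ι → ℤ) := fun d i =>
    ∑ j : Finset.range a, if (j : ℕ) < n i then d j else 0
  let ψ : (Finset.Ico a b → ℤ) → ℤ := fun d => ∑ j, d j
  have h2 := h1.comp (φ := φ) (ψ := ψ)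
    (by
      refine measurable_pi_lambda _ fun i => Finset.measurable_sum _ fun j _ => ?_
      split_ifs <;> fun_prop) (by fun_prop)
  convert! h2 using 1
  · ext ω i
    have hi := hn i
    simp only [φ, Function.comp]
    rw [Finset.sum_coe_sort (Finset.range a)
      (fun j => if j < n i then Y j ω else 0), ← Finset.sum_filter]
    have : (Finset.range a).filter (fun j => j < n i) = Finset.range (n i) := by
      ext j; simp; omega
    rw [this, partialSum]
  · ext ω
    simp only [ψ, Function.comp]
    rw [Finset.sum_coe_sort (Finset.Ico a b) (fun j => Y j ω), Finset.sum_Ico_eq_sub _ hab]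
    rfl

lemma measurable_count_path (h : IsFairCompound lam N Y P) : Measurable fun ω t => N t ω :=
  measurable_pi_lambda _ h.poisson.measurable

lemma measurable_jump_path (h : IsFairCompound lam N Y P) : Measurable fun ω i => Y i ω :=
  measurable_pi_lambda _ h.measurable_jump

lemma measurable_compoundSum (h : IsFairCompound lam N Y P) (t : ℝ≥0) :
    Measurable (compoundSum N Y t) :=
  (measurable_partialSum_coord t).comp (h.measurable_count_path.prodMk h.measurable_jump_path)

lemma measure_compoundSum_sub (h : IsFairCompound lam N Y P) {s t : ℝ≥0} (hst : s ≤ t)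
    (A : Set ℤ) :
    P {ω | compoundSum N Y t ω - compoundSum N Y s ω ∈ A} =
      ∫⁻ ω, P {ω' | partialSum (fun i => Y i ω') (N t ω - N s ω) ∈ A} ∂P := by
  have hB : MeasurableSet {q : (ℝ≥0 → ℕ) × (ℕ → ℤ) |
      partialSum q.2 (q.1 t) - partialSum q.2 (q.1 s) ∈ A} :=
    ((measurable_partialSum_coord t).sub (measurable_partialSum_coord s)) (MeasurableSet.of_discrete)
  have := IndepFun.measure_mem_eq_lintegral h.measurable_count_path h.measurable_jump_path
    h.indep_count_jumps hB
  refine this.trans (lintegral_congr fun ω => ?_)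
  exact h.measure_partialSum_sub (h.poisson.mono ω hst)

/-- The increments of the compound sum are stationary. -/
lemma map_compoundSum_sub (h : IsFairCompound lam N Y P) {s t : ℝ≥0} (hst : s ≤ t) :
    P.map (fun ω => compoundSum N Y t ω - compoundSum N Y s ω) =
      P.map (compoundSum N Y (t - s)) := by
  -- The increment is a Poisson mixture of partial sums, and the mixing law depends on `t - s` only.
  have key : ∀ {s t : ℝ≥0}, s ≤ t → ∀ A : Set ℤ,
      P {ω | compoundSum N Y t ω - compoundSum N Y s ω ∈ A} =
      ∫⁻ n, P {ω' | partialSum (fun i => Y i ω') n ∈ A} ∂(poissonMeasure (lam * (t - s))) := by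
    intro s t hst A
    rw [h.measure_compoundSum_sub hst,
      ← (h.poisson.law_increment s t hst).lintegral_comp
        (f := fun n => P {ω' | partialSum (fun i => Y i ω') n ∈ A}) Measurable.of_discrete.aemeasurable]
  ext A hA
  have hm : Measurable fun ω => compoundSum N Y t ω - compoundSum N Y s ω :=
    (h.measurable_compoundSum t).sub (h.measurable_compoundSum s)
  rw [Measure.map_apply hm hA,
    Measure.map_apply (h.measurable_compoundSum _) hA]
  have h1 := key hst A
  have h2 := key (zero_le (a := t - s)) A
  rw [tsub_zero, ← h1] at h2
  refine h2.symm.trans ?_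
  congr 1
  ext ω
  simp [compoundSum, h.poisson.start, partialSum]

/-- The increment of the compound sum after a time is independent of its values before it. -/
lemma indepFun_compoundSum (h : IsFairCompound lam N Y P) {t : ℕ → ℝ≥0} (ht : Monotone t) (m : ℕ) :
    IndepFun (fun ω (i : Finset.range (m + 1)) => compoundSum N Y (t i) ω)
      (fun ω => compoundSum N Y (t (m + 1)) ω - compoundSum N Y (t m) ω) P := by
  rw [indepFun_iff_measure_inter_preimage_eq_mul]
  intro B A hB hA
  have hpast : Measurable fun q : (ℝ≥0 → ℕ) × (ℕ → ℤ) =>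
      fun i : Finset.range (m + 1) => partialSum q.2 (q.1 (t i)) :=
    measurable_pi_lambda _ fun i => measurable_partialSum_coord _
  have hincr : Measurable fun q : (ℝ≥0 → ℕ) × (ℕ → ℤ) =>
      partialSum q.2 (q.1 (t (m + 1))) - partialSum q.2 (q.1 (t m)) :=
    (measurable_partialSum_coord _).sub (measurable_partialSum_coord _)
  have h1 := IndepFun.measure_mem_eq_lintegral h.measurable_count_path h.measurable_jump_path
    h.indep_count_jumps ((hpast hB).inter (hincr hA))
  have h2 := IndepFun.measure_mem_eq_lintegral h.measurable_count_path h.measurable_jump_path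
    h.indep_count_jumps (hpast hB)
  have h3 := h.measure_compoundSum_sub (ht m.le_succ) A
  refine h1.trans ?_
  -- With the counts frozen, past values and increment use disjoint blocks of jumps, so the
  -- conditional probability factors.
  have h4 : ∀ ω, P {ω' | ((fun t => N t ω), fun i => Y i ω') ∈
      ((fun q : (ℝ≥0 → ℕ) × (ℕ → ℤ) =>
      fun i : Finset.range (m + 1) => partialSum q.2 (q.1 (t i))) ⁻¹' B) ∩
      ((fun q : (ℝ≥0 → ℕ) × (ℕ → ℤ) =>
      partialSum q.2 (q.1 (t (m + 1))) - partialSum q.2 (q.1 (t m))) ⁻¹' A)} =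
      P {ω' | (fun i : Finset.range (m + 1) => partialSum (fun j => Y j ω') (N (t i) ω)) ∈ B} *
      P {ω' | partialSum (fun i => Y i ω') (N (t (m + 1)) ω - N (t m) ω) ∈ A} := by
    intro ω
    rw [← h.measure_partialSum_sub (h.poisson.mono ω (ht m.le_succ))]
    exact (h.indepFun_partialSum (fun i : Finset.range (m + 1) => N (t i) ω)
      (fun i => h.poisson.mono ω (ht (by have := Finset.mem_range.1 i.2; omega)))
      (h.poisson.mono ω (ht m.le_succ))).measure_inter_preimage_eq_mul B A hB hA
  rw [lintegral_congr h4]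
  -- The two factors are functions of the past counts and of the next count increment, so their
  -- product also integrates to a product.
  have h5 := (h.poisson.indepFun_past ht m).comp
    (φ := fun n => P {ω' | (fun i => partialSum (fun j => Y j ω') (n i)) ∈ B})
    (ψ := fun k => P {ω' | partialSum (fun i => Y i ω') k ∈ A}) .of_discrete .of_discrete
  refine (lintegral_mul_eq_lintegral_mul_lintegral_of_indepFun'' ?_ ?_ h5).trans ?_
  rotate_left 2
  · exact congrArg₂ (· * ·) h2.symm h3.symm
  · exact (Measurable.of_discrete.comp (measurable_pi_lambda _ fun i => h.poisson.measurable _)).aemeasurable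
  · exact (Measurable.of_discrete.comp ((h.poisson.measurable _).sub (h.poisson.measurable _))).aemeasurable

end IsFairCompound

end

/-! ### Poisson moments, and estimates of the compound sum over short times. -/

open scoped Nat in
lemma hasSum_mul_poissonMeasure (r : ℝ≥0) :
    HasSum (fun n : ℕ => Real.exp (-r) * r ^ n / (n)! * (n : ℝ)) r := by
  rw [← hasSum_nat_add_iff' 1]
  have h := (hasSum_one_poissonMeasure r).mul_left (r : ℝ)
  simp only [mul_one] at h
  convert! h using 1
  · ext n
    rw [Nat.factorial_succ]
    push_cast
    field_simp
    ring
  · simp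

lemma integrable_natCast_poissonMeasure (r : ℝ≥0) :
    Integrable (fun n : ℕ => (n : ℝ)) (poissonMeasure r) := by
  rw [integrable_poissonMeasure_iff]
  simpa using (hasSum_mul_poissonMeasure r).summable

lemma integral_natCast_poissonMeasure (r : ℝ≥0) :
    ∫ n : ℕ, (n : ℝ) ∂(poissonMeasure r) = r := by
  rw [integral_poissonMeasure]
  exact (hasSum_mul_poissonMeasure r).tsum_eq

lemma poissonMeasure_real_zero (r : ℝ≥0) : (poissonMeasure r).real {0} = Real.exp (-r) := by
  simp [poissonMeasure_real_singleton]

lemma poissonMeasure_real_one (r : ℝ≥0) : (poissonMeasure r).real {1} = Real.exp (-r) * r := by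
  simp [poissonMeasure_real_singleton]

/-- The mean minus the mass at `1` is `r * (1 - exp (-r))`, which is at most `r ^ 2`. -/
lemma integral_two_le_poissonMeasure (r : ℝ≥0) :
    ∫ n : ℕ, (if 2 ≤ n then (n : ℝ) else 0) ∂(poissonMeasure r) ≤ (r : ℝ) ^ 2 := by
  have h : (fun n : ℕ => (if 2 ≤ n then (n : ℝ) else 0)) =
      fun n : ℕ => (n : ℝ) - Set.indicator {1} (fun _ => (1 : ℝ)) n := by
    ext n
    rcases n with _ | _ | n <;> simp
  rw [h, integral_sub (integrable_natCast_poissonMeasure r)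
    ((integrable_const _).indicator (measurableSet_singleton 1)),
    integral_natCast_poissonMeasure, integral_indicator_const _ (measurableSet_singleton 1),
    poissonMeasure_real_one]
  have := Real.add_one_le_exp (-(r : ℝ))
  have hr := r.coe_nonneg
  simp only [smul_eq_mul, mul_one]
  nlinarith

lemma integrable_pow_poissonMeasure (r : ℝ≥0) {K : ℝ} (hK : 0 ≤ K) :
    Integrable (fun n : ℕ => K ^ n) (poissonMeasure r) := by
  rw [integrable_poissonMeasure_iff]
  have h := ((Real.summable_pow_div_factorial (r * K)).mul_left (Real.exp (-r)))
  refine h.congr fun n => ?_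
  rw [Real.norm_of_nonneg (by positivity), mul_pow]
  ring

namespace IsFairCompound

set_option linter.unusedSectionVars false

variable {Ω : Type*} [MeasurableSpace Ω] {P : Measure Ω} [IsProbabilityMeasure P]
  {lam : ℝ≥0} {N : ℝ≥0 → Ω → ℕ} {Y : ℕ → Ω → ℤ}

lemma hasLaw_count (h : IsFairCompound lam N Y P) (t : ℝ≥0) :
    HasLaw (N t) (poissonMeasure (lam * t)) P := by
  have := h.poisson.law_increment 0 t zero_le
  simpa [h.poisson.start] using this

lemma integrable_comp_count (h : IsFairCompound lam N Y P) (t : ℝ≥0) {f : ℕ → ℝ}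
    (hf : Integrable f (poissonMeasure (lam * t))) : Integrable (fun ω => f (N t ω)) P := by
  rw [← (h.hasLaw_count t).map_eq] at hf
  exact hf.comp_measurable (h.poisson.measurable t)

lemma integral_comp_count (h : IsFairCompound lam N Y P) (t : ℝ≥0) (f : ℕ → ℝ) :
    ∫ ω, f (N t ω) ∂P = ∫ n, f n ∂(poissonMeasure (lam * t)) :=
  (h.hasLaw_count t).integral_comp Measurable.of_discrete.aestronglyMeasurable

lemma measureReal_count (h : IsFairCompound lam N Y P) (t : ℝ≥0) (A : Set ℕ) :
    P.real {ω | N t ω ∈ A} = (poissonMeasure (lam * t)).real A :=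
  (h.hasLaw_count t).measureReal_eq MeasurableSet.of_discrete

lemma ae_abs_compoundSum_le (h : IsFairCompound lam N Y P) (t : ℝ≥0) :
    ∀ᵐ ω ∂P, |compoundSum N Y t ω| ≤ N t ω := by
  filter_upwards [ae_all_iff.2 h.ae_jump] with ω hω
  refine (Finset.abs_sum_le_sum_abs (fun i => Y i ω) (Finset.range (N t ω))).trans ?_
  calc ∑ i ∈ Finset.range (N t ω), |Y i ω| ≤ ∑ i ∈ Finset.range (N t ω), (1 : ℤ) :=
        Finset.sum_le_sum fun i _ => by rcases hω i with h | h <;> simp [h]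
    _ = N t ω := by simp

lemma integrable_compoundSum (h : IsFairCompound lam N Y P) (t : ℝ≥0) :
    Integrable (fun ω => (compoundSum N Y t ω : ℝ)) P := by
  refine (h.integrable_comp_count t (integrable_natCast_poissonMeasure _)).mono'
    (Measurable.of_discrete.comp (h.measurable_compoundSum t)).aestronglyMeasurable ?_
  filter_upwards [h.ae_abs_compoundSum_le t] with ω hω
  rw [Real.norm_eq_abs]
  exact_mod_cast hω

/-- Flipping all the fair jumps preserves the joint law of counts and jumps. This yields mean zero
without any conditioning on the number of jumps. -/
lemma identDistrib_neg (h : IsFairCompound lam N Y P) (t : ℝ≥0) :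
    IdentDistrib (compoundSum N Y t) (fun ω => -compoundSum N Y t ω) P P := by
  have hj : ∀ i, IdentDistrib (Y i) (fun ω => -Y i ω) P P := by
    intro i
    refine ⟨(h.measurable_jump i).aemeasurable, (h.measurable_jump i).neg.aemeasurable, ?_⟩
    have hm := h.measurable_jump i
    refine Measure.ext_of_singleton fun k => ?_
    have hm' : Measurable fun ω => -Y i ω := hm.neg
    rw [Measure.map_apply hm (measurableSet_singleton k),
      Measure.map_apply hm' (measurableSet_singleton k)]
    by_cases h1 : k = 1
    · subst h1
      refine (h.jump_up i).trans ((h.jump_down i).symm.trans ?_)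
      congr 1; ext ω; simp; omega
    by_cases h2 : k = -1
    · subst h2
      refine (h.jump_down i).trans ((h.jump_up i).symm.trans ?_)
      congr 1; ext ω; simp
    · have hae := h.ae_jump i
      have e1 : P (Y i ⁻¹' {k}) = 0 := by
        refine measure_mono_null ?_ hae
        intro ω hω
        simp only [Set.mem_preimage, Set.mem_singleton_iff] at hω
        simp [hω, h1, h2]
      have e2 : P ((fun ω => -Y i ω) ⁻¹' {k}) = 0 := by
        refine measure_mono_null ?_ hae
        intro ω hω
        simp only [Set.mem_preimage, Set.mem_singleton_iff] at hω
        simp only [Set.mem_compl_iff, Set.mem_ofPred_eq]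
        omega
      exact e1.trans e2.symm
  have h1 : IdentDistrib (fun ω i => Y i ω) (fun ω i => -Y i ω) P P :=
    IdentDistrib.pi hj h.indep_jumps (h.indep_jumps.comp (fun _ k => -k) fun _ => .of_discrete)
  have h2 : Measurable fun y : ℕ → ℤ => fun i => -y i := by fun_prop
  have h3 := (IdentDistrib.refl h.measurable_count_path.aemeasurable).prodMk h1
    h.indep_count_jumps (h.indep_count_jumps.comp measurable_id h2)
  have h4 := h3.comp (measurable_partialSum_coord t)
  convert! h4 using 1
  ext ω
  simp [compoundSum, partialSum]

lemma integral_compoundSum (h : IsFairCompound lam N Y P) (t : ℝ≥0) :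
    ∫ ω, (compoundSum N Y t ω : ℝ) ∂P = 0 := by
  have h1 := ((h.identDistrib_neg t).comp (u := fun k : ℤ => (k : ℝ)) .of_discrete).integral_eq
  simp only [Function.comp_def, Int.cast_neg, integral_neg] at h1
  linarith

lemma measureReal_one_jump (h : IsFairCompound lam N Y P) (t : ℝ≥0) :
    P.real {ω | N t ω = 1 ∧ Y 0 ω = -1} = Real.exp (-(lam * t)) * (lam * t) / 2 := by
  have h1 := (h.indep_count_jumps.comp (φ := fun n => n t) (ψ := fun y => y 0)
    (measurable_pi_apply _) (measurable_pi_apply _)).measure_inter_preimage_eq_mul {1} {-1}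
    (measurableSet_singleton _) (measurableSet_singleton _)
  have h2 := congrArg ENNReal.toReal h1
  rw [ENNReal.toReal_mul] at h2
  have h3 := h.measureReal_count t {1}
  rw [poissonMeasure_real_one] at h3
  have h4 : (P ((fun y : ℕ → ℤ => y 0) ∘ (fun ω i => Y i ω) ⁻¹' {-1})).toReal = 1 / 2 := by
    refine (congrArg ENNReal.toReal (h.jump_down 0)).trans ?_
    simp
  refine h2.trans ?_
  have h5 : (P ((fun n : ℝ≥0 → ℕ => n t) ∘ (fun ω t => N t ω) ⁻¹' {1})).toReal =
    Real.exp (-(lam * t)) * (lam * t) := by exact_mod_cast h3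
  rw [h5, h4]
  ring

lemma one_jump_subset (N : ℝ≥0 → Ω → ℕ) (Y : ℕ → Ω → ℤ) (t : ℝ≥0) :
    {ω | N t ω = 1 ∧ Y 0 ω = -1} ⊆ {ω | compoundSum N Y t ω = -1} := by
  rintro ω ⟨h1, h2⟩
  simp [compoundSum, partialSum, h1, h2]

lemma measureReal_ne_zero_le (h : IsFairCompound lam N Y P) (t : ℝ≥0) :
    P.real {ω | compoundSum N Y t ω ≠ 0} ≤ lam * t := by
  have h1 : {ω | compoundSum N Y t ω ≠ 0} ⊆ {ω | N t ω ∈ ({0}ᶜ : Set ℕ)} := by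
    intro ω hω h0
    apply hω
    have : N t ω = 0 := h0
    simp [compoundSum, partialSum, this]
  refine (measureReal_mono h1).trans ?_
  rw [h.measureReal_count, probReal_compl_eq_one_sub (measurableSet_singleton 0),
    poissonMeasure_real_zero]
  have := Real.add_one_le_exp (-((lam * t : ℝ≥0) : ℝ))
  push_cast at this ⊢
  linarith

lemma integral_two_le_count (h : IsFairCompound lam N Y P) (t : ℝ≥0) :
    ∫ ω, (if 2 ≤ N t ω then (N t ω : ℝ) else 0) ∂P ≤ (lam * t : ℝ) ^ 2 := by
  have := integral_two_le_poissonMeasure (lam * t)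
  rw [← h.integral_comp_count t] at this
  exact_mod_cast this

lemma integrable_two_le_count (h : IsFairCompound lam N Y P) (t : ℝ≥0) :
    Integrable (fun ω => if 2 ≤ N t ω then (N t ω : ℝ) else 0) P := by
  refine (h.integrable_comp_count t (integrable_natCast_poissonMeasure _)).mono'
    (Measurable.of_discrete (f := fun n : ℕ => if 2 ≤ n then (n : ℝ) else 0) |>.comp
      (h.poisson.measurable t)).aestronglyMeasurable ?_
  refine ae_of_all _ fun ω => ?_
  split_ifs <;> simp

/-- Passing `-1` takes at least two jumps, hence a second-order contribution. -/
lemma integral_le_neg_two (h : IsFairCompound lam N Y P) (t : ℝ≥0) :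
    ∫ ω, (if compoundSum N Y t ω ≤ -2 then -(compoundSum N Y t ω : ℝ) else 0) ∂P ≤
      (lam * t : ℝ) ^ 2 := by
  refine le_trans (integral_mono_of_nonneg ?_ (h.integrable_two_le_count t) ?_)
    (h.integral_two_le_count t)
  · refine ae_of_all _ fun ω => ?_
    simp only [Pi.zero_apply]
    split_ifs with h1
    · have : (compoundSum N Y t ω : ℝ) ≤ -2 := by exact_mod_cast h1
      linarith
    · exact le_rfl
  · filter_upwards [h.ae_abs_compoundSum_le t] with ω hω
    have h1 := abs_le.1 hω
    split_ifs with h2 h3 h3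
    · have : -(N t ω : ℝ) ≤ compoundSum N Y t ω := by exact_mod_cast h1.1
      linarith
    · omega
    · positivity
    · exact le_rfl

/-- Up to the second-order event of two or more jumps, this is one single downward jump, of
probability `exp (-u) * u / 2` with `u = lam * t`. -/
lemma abs_measureReal_neg_one_sub_le (h : IsFairCompound lam N Y P) (t : ℝ≥0) :
    |P.real {ω | compoundSum N Y t ω = -1} - lam * t / 2| ≤ (lam * t : ℝ) ^ 2 := by
  have h1 := measureReal_mono (μ := P) (one_jump_subset N Y t)
  rw [h.measureReal_one_jump] at h1
  have hr : (0 : ℝ) ≤ lam * t := by positivity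
  have he := Real.add_one_le_exp (-((lam : ℝ) * t))
  have he' : Real.exp (-((lam : ℝ) * t)) ≤ 1 := by simpa using hr
  have h2 : P.real {ω | compoundSum N Y t ω = -1} ≤
      P.real ({ω | N t ω = 1 ∧ Y 0 ω = -1} ∪ {ω | 2 ≤ N t ω}) := by
    refine ENNReal.toReal_mono (measure_ne_top _ _) (measure_mono_ae ?_)
    filter_upwards [h.ae_abs_compoundSum_le t] with ω hω hS
    have hS' : compoundSum N Y t ω = -1 := hS
    rw [hS'] at hω
    by_cases h3 : 2 ≤ N t ω
    · exact Or.inr h3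
    · left
      have h4 : N t ω = 1 := by
        have : (1 : ℤ) ≤ N t ω := by simpa using hω
        omega
      refine ⟨h4, ?_⟩
      simpa [compoundSum, partialSum, h4] using hS'
  have h3 : P.real {ω | 2 ≤ N t ω} ≤ (lam * t : ℝ) ^ 2 := by
    refine le_trans ?_ (h.integral_two_le_count t)
    have hm : MeasurableSet {ω | 2 ≤ N t ω} :=
      h.poisson.measurable t (MeasurableSet.of_discrete (s := {n | 2 ≤ n}))
    rw [← integral_indicator_one hm]
    refine integral_mono ((integrable_const _).indicator hm) (h.integrable_two_le_count t) ?_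
    intro ω
    by_cases h4 : 2 ≤ N t ω
    · have : (2 : ℝ) ≤ N t ω := by exact_mod_cast h4
      simp [h4]; linarith
    · simp [h4]
  have h4 := h2.trans (measureReal_union_le _ _)
  rw [h.measureReal_one_jump] at h4
  rw [abs_le]
  constructor <;> nlinarith

lemma measureReal_neg_pos (h : IsFairCompound lam N Y P) (hlam : 0 < lam) {t : ℝ≥0} (ht : 0 < t) :
    0 < P.real {ω | compoundSum N Y t ω < 0} := by
  refine lt_of_lt_of_le ?_ (measureReal_mono (μ := P) (s₁ := {ω | N t ω = 1 ∧ Y 0 ω = -1}) ?_)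
  · rw [h.measureReal_one_jump]; positivity
  · intro ω hω
    have : compoundSum N Y t ω = -1 := one_jump_subset N Y t hω
    simp [this]

lemma measureReal_nonpos_pos (h : IsFairCompound lam N Y P) (t : ℝ≥0) :
    0 < P.real {ω | compoundSum N Y t ω ≤ 0} := by
  have h1 := h.measureReal_count t {0}
  rw [poissonMeasure_real_zero] at h1
  refine lt_of_lt_of_le ?_ (measureReal_mono (μ := P) (s₁ := {ω | N t ω ∈ ({0} : Set ℕ)}) ?_)
  · rw [h1]; positivity
  · intro ω hω
    have : N t ω = 0 := hω
    simp [compoundSum, partialSum, this]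

/-- The lower tails of the compound sum decay faster than any exponential. -/
lemma exists_tail_bound (h : IsFairCompound lam N Y P) (t : ℝ≥0) {K : ℝ} (hK : 1 ≤ K) :
    ∃ M, ∀ n : ℕ, K ^ n * P.real {ω | compoundSum N Y t ω ≤ -n} ≤ M := by
  have hint := h.integrable_comp_count t (integrable_pow_poissonMeasure (lam * t) (by linarith : 0 ≤ K))
  refine ⟨∫ ω, K ^ (N t ω) ∂P, fun n => ?_⟩
  -- Reaching `-n` takes at least `n` jumps; Markov's inequality for `K ^ N t` does the rest.
  have h1 : P.real {ω | compoundSum N Y t ω ≤ -n} ≤ P.real {ω | K ^ n ≤ K ^ (N t ω)} := by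
    refine ENNReal.toReal_mono (measure_ne_top _ _) (measure_mono_ae ?_)
    filter_upwards [h.ae_abs_compoundSum_le t] with ω hω hS
    have hS' : compoundSum N Y t ω ≤ -n := hS
    have := (abs_le.1 hω).1
    exact pow_le_pow_right₀ hK (by omega)
  have h2 := mul_meas_ge_le_integral_of_nonneg (μ := P) (f := fun ω => K ^ (N t ω))
    (ae_of_all _ fun ω => by positivity) hint (K ^ n)
  exact (mul_le_mul_of_nonneg_left h1 (by positivity)).trans h2

end IsFairCompound

/-! ### The killed walk in discrete time and its almost harmonic functions. -/

/-- A function on the integers of at most linear growth. -/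
def LinearGrowth (f : ℤ → ℝ) : Prop := ∃ C, 0 ≤ C ∧ ∀ k, |f k| ≤ C * (1 + |(k : ℝ)|)

/-- The one-step weight of a walk that is killed below `0` and discounted by `a` at `0`. -/
noncomputable def killWeight (a : ℝ) (k : ℤ) : ℝ := if k < 0 then 0 else if k = 0 then a else 1

/-- The one-step operator of the killed walk with step law `ν`. -/
noncomputable def killedStep (ν : Measure ℤ) (a : ℝ) (f : ℤ → ℝ) (k : ℤ) : ℝ :=
  ∫ j, killWeight a (k + j) * f (k + j) ∂ν

lemma killWeight_nonneg {a : ℝ} (ha : 0 ≤ a) (k : ℤ) : 0 ≤ killWeight a k := by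
  unfold killWeight; split_ifs <;> linarith

lemma killWeight_le_one {a : ℝ} (ha : a ≤ 1) (k : ℤ) : killWeight a k ≤ 1 := by
  unfold killWeight; split_ifs <;> linarith

lemma abs_killWeight_mul_le {a : ℝ} (ha : 0 ≤ a) (ha1 : a ≤ 1) (k : ℤ) (y : ℝ) :
    |killWeight a k * y| ≤ |y| := by
  rw [abs_mul, abs_of_nonneg (killWeight_nonneg ha k)]
  exact mul_le_of_le_one_left (abs_nonneg _) (killWeight_le_one ha1 k)

lemma LinearGrowth.abs_add_le {f : ℤ → ℝ} {C : ℝ} (hC : 0 ≤ C)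
    (hf : ∀ k, |f k| ≤ C * (1 + |(k : ℝ)|)) (k j : ℤ) :
    |f (k + j)| ≤ C * (1 + |(k : ℝ)| + |(j : ℝ)|) := by
  refine (hf _).trans (mul_le_mul_of_nonneg_left ?_ hC)
  push_cast
  linarith [_root_.abs_add_le (k : ℝ) j]

lemma LinearGrowth.integrable_add {f : ℤ → ℝ} (hf : LinearGrowth f) {Ω : Type*} [MeasurableSpace Ω]
    {P : Measure Ω} [IsFiniteMeasure P] {Z : Ω → ℤ} (hZ : Measurable Z)
    (hint : Integrable (fun ω => (Z ω : ℝ)) P) (k : ℤ) : Integrable (fun ω => f (k + Z ω)) P := by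
  obtain ⟨C, hC, hf⟩ := hf
  refine (((integrable_const (1 + |(k : ℝ)|)).add hint.abs).const_mul C).mono'
    ((Measurable.of_discrete (f := fun j => f (k + j))).comp hZ).aestronglyMeasurable
    (ae_of_all _ fun ω => ?_)
  exact LinearGrowth.abs_add_le hC hf k (Z ω)

lemma LinearGrowth.killWeight_mul {f : ℤ → ℝ} (hf : LinearGrowth f) {a : ℝ} (ha : 0 ≤ a)
    (ha1 : a ≤ 1) : LinearGrowth fun k => killWeight a k * f k := by
  obtain ⟨C, hC, hf⟩ := hf
  exact ⟨C, hC, fun k => (abs_killWeight_mul_le ha ha1 k _).trans (hf k)⟩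

lemma linearGrowth_add_const (c : ℝ) : LinearGrowth fun k => (k : ℝ) + c := by
  refine ⟨1 + |c|, by positivity, fun k => (_root_.abs_add_le _ _).trans ?_⟩
  nlinarith [abs_nonneg (k : ℝ), abs_nonneg c]

lemma linearGrowth_const (c : ℝ) : LinearGrowth fun _ => c := by
  refine ⟨|c|, by positivity, fun k => ?_⟩
  nlinarith [abs_nonneg (k : ℝ), abs_nonneg c]

section

variable {ν : Measure ℤ} [IsProbabilityMeasure ν] (hν : Integrable (fun j : ℤ => (j : ℝ)) ν)
  {a : ℝ} (ha : 0 ≤ a) (ha1 : a ≤ 1)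

include hν ha ha1

lemma linearGrowth_killedStep {f : ℤ → ℝ} (hf : LinearGrowth f) :
    LinearGrowth (killedStep ν a f) := by
  have hf' := hf
  obtain ⟨C, hC, hf⟩ := hf
  set I := ∫ j : ℤ, |(j : ℝ)| ∂ν
  have hI : 0 ≤ I := integral_nonneg fun j => abs_nonneg _
  refine ⟨C * (1 + I), by positivity, fun k => ?_⟩
  have h1 : |killedStep ν a f k| ≤ ∫ j : ℤ, C * (1 + |(k : ℝ)| + |(j : ℝ)|) ∂ν := by
    refine (abs_integral_le_integral_abs).trans (integral_mono ?_ ?_ fun j => ?_)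
    · exact ((hf'.killWeight_mul ha ha1).integrable_add measurable_id hν k).abs
    · exact ((integrable_const _).add hν.abs).const_mul C
    · exact (abs_killWeight_mul_le ha ha1 _ _).trans (LinearGrowth.abs_add_le hC hf k j)
  rw [integral_const_mul, integral_add (integrable_const _) hν.abs, integral_const] at h1
  simp only [probReal_univ, one_smul] at h1
  refine h1.trans ?_
  have : 0 ≤ C * (I * |(k : ℝ)|) := by positivity
  nlinarith

lemma linearGrowth_iterate_killedStep {f : ℤ → ℝ} (hf : LinearGrowth f) (n : ℕ) :
    LinearGrowth ((killedStep ν a)^[n] f) := by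
  induction n with
  | zero => exact hf
  | succ n ih =>
    rw [Function.iterate_succ_apply']
    exact linearGrowth_killedStep hν ha ha1 ih

/-- The weight vanishes below `0`, so closeness on the nonnegative integers suffices and the
operator is a contraction there. -/
lemma abs_killedStep_sub_le {f g : ℤ → ℝ} (hf : LinearGrowth f) (hg : LinearGrowth g) {ε : ℝ}
    (hε : 0 ≤ ε) (h : ∀ k, 0 ≤ k → |f k - g k| ≤ ε) (k : ℤ) :
    |killedStep ν a f k - killedStep ν a g k| ≤ ε := by
  have hf1 := (hf.killWeight_mul ha ha1).integrable_add measurable_id hν k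
  have hg1 := (hg.killWeight_mul ha ha1).integrable_add measurable_id hν k
  simp only [id] at hf1 hg1
  unfold killedStep
  rw [← integral_sub hf1 hg1]
  refine (abs_integral_le_integral_abs).trans ?_
  have h1 : ∫ j : ℤ, |killWeight a (k + j) * f (k + j) - killWeight a (k + j) * g (k + j)| ∂ν ≤
      ∫ j : ℤ, ε ∂ν := by
    refine integral_mono (hf1.sub hg1).abs (integrable_const _) fun j => ?_
    simp only
    rw [← mul_sub]
    by_cases hk : k + j < 0
    · simp [killWeight, hk, hε]
    · exact (abs_killWeight_mul_le ha ha1 _ _).trans (h _ (not_lt.1 hk))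
  simpa using h1

/-- By contraction the one-step defects merely add up. -/
lemma abs_iterate_killedStep_sub_le {f : ℤ → ℝ} (hf : LinearGrowth f) {ε : ℝ} (hε : 0 ≤ ε)
    (h : ∀ k, 0 ≤ k → |killedStep ν a f k - f k| ≤ ε) (n : ℕ) {k : ℤ} (hk : 0 ≤ k) :
    |(killedStep ν a)^[n] f k - f k| ≤ n * ε := by
  induction n generalizing k with
  | zero => simp
  | succ n ih =>
    rw [Function.iterate_succ_apply']
    have h1 := abs_killedStep_sub_le hν ha ha1 (linearGrowth_iterate_killedStep hν ha ha1 hf n) hf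
      (by positivity) (fun k hk => ih hk) k
    have h2 := h k hk
    have h3 := abs_sub_le (killedStep ν a ((killedStep ν a)^[n] f) k) (killedStep ν a f k) (f k)
    push_cast
    linarith

end

/-- From `exp x ≥ 1 + x` and `(1 + x) * (1 - x + x ^ 2) = 1 + x ^ 3 ≥ 1`. -/
lemma Real.exp_neg_le_one_sub_add_sq {x : ℝ} (hx : 0 ≤ x) : Real.exp (-x) ≤ 1 - x + x ^ 2 := by
  rw [Real.exp_neg, inv_le_comm₀ (Real.exp_pos x) (by nlinarith [sq_nonneg (x - 1)])]
  refine le_trans ?_ (Real.add_one_le_exp x)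
  rw [inv_le_iff_one_le_mul₀ (by nlinarith [sq_nonneg (x - 1)])]
  nlinarith [pow_nonneg hx 3]

section

variable {Ω : Type*} [MeasurableSpace Ω] {P : Measure Ω} [IsProbabilityMeasure P]

lemma IndepFun.integral_comp_eq {α β : Type*} [MeasurableSpace α] [MeasurableSpace β]
    {U : Ω → α} {V : Ω → β} (hU : Measurable U) (hV : Measurable V) (h : IndepFun U V P)
    {F : α × β → ℝ} (hF : Measurable F) (hint : Integrable (fun ω => F (U ω, V ω)) P) :
    ∫ ω, F (U ω, V ω) ∂P = ∫ ω, ∫ b, F (U ω, b) ∂(P.map V) ∂P := by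
  have hUV := hU.prodMk hV
  have h2 := h.map_prod_eq_prod_map_map hU.aemeasurable hV.aemeasurable
  have := Measure.isProbabilityMeasure_map hU.aemeasurable (μ := P)
  have := Measure.isProbabilityMeasure_map hV.aemeasurable (μ := P)
  have h3 : Integrable F ((P.map U).prod (P.map V)) := by
    rw [← h2, integrable_map_measure hF.aestronglyMeasurable hUV.aemeasurable]
    exact hint
  rw [← integral_map (f := F) hUV.aemeasurable hF.aestronglyMeasurable, h2, integral_prod F h3]
  exact integral_map hU.aemeasurable
    (hF.stronglyMeasurable.integral_prod_right').aestronglyMeasurable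

namespace IsFairCompound

variable {lam : ℝ≥0} {N : ℝ≥0 → Ω → ℕ} {Y : ℕ → Ω → ℤ}

lemma integrable_id_map (h : IsFairCompound lam N Y P) (t : ℝ≥0) :
    Integrable (fun j : ℤ => (j : ℝ)) (P.map (compoundSum N Y t)) := by
  rw [integrable_map_measure Measurable.of_discrete.aestronglyMeasurable
    (h.measurable_compoundSum t).aemeasurable]
  exact h.integrable_compoundSum t

/-- The one-step Markov property of the killed walk along an arithmetic progression of times. -/
lemma integral_killWeight_mul (h : IsFairCompound lam N Y P) {t : ℕ → ℝ≥0} {η : ℝ≥0}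
    (ht : ∀ i, t (i + 1) = t i + η) (x : ℤ) (m : ℕ) {r : (Finset.range (m + 1) → ℤ) → ℝ}
    (hr : ∀ z, |r z| ≤ 1) {a : ℝ} (ha : 0 ≤ a) (ha1 : a ≤ 1) {f : ℤ → ℝ} (hf : LinearGrowth f) :
    ∫ ω, r (fun i => compoundSum N Y (t i) ω) *
        (killWeight a (x + compoundSum N Y (t (m + 1)) ω) *
          f (x + compoundSum N Y (t (m + 1)) ω)) ∂P =
      ∫ ω, r (fun i => compoundSum N Y (t i) ω) *
        killedStep (P.map (compoundSum N Y η)) a f (x + compoundSum N Y (t m) ω) ∂P := by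
  have hmono : Monotone t := monotone_nat_of_le_succ fun n => by rw [ht]; exact le_self_add
  have hind := h.indepFun_compoundSum hmono m
  have hU : Measurable fun ω (i : Finset.range (m + 1)) => compoundSum N Y (t i) ω :=
    measurable_pi_lambda _ fun i => h.measurable_compoundSum _
  have hV : Measurable fun ω => compoundSum N Y (t (m + 1)) ω - compoundSum N Y (t m) ω :=
    (h.measurable_compoundSum _).sub (h.measurable_compoundSum _)
  let mm : Finset.range (m + 1) := ⟨m, by simp⟩
  have hF : Measurable fun q : (Finset.range (m + 1) → ℤ) × ℤ =>
    r q.1 * (killWeight a (x + q.1 mm + q.2) * f (x + q.1 mm + q.2)) := .of_discrete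
  have hsum : ∀ ω, x + compoundSum N Y (t m) ω +
      (compoundSum N Y (t (m + 1)) ω - compoundSum N Y (t m) ω) =
      x + compoundSum N Y (t (m + 1)) ω := fun ω => by ring
  have key := IndepFun.integral_comp_eq hU hV hind hF (by
    simp only [mm, hsum]
    have h1 := (hf.killWeight_mul ha ha1).integrable_add (h.measurable_compoundSum (t (m + 1)))
      (h.integrable_compoundSum (t (m + 1))) x
    refine h1.bdd_mul (c := 1) ((Measurable.of_discrete (f := r)).comp hU).aestronglyMeasurable
      (ae_of_all _ fun ω => hr _))
  simp only [mm, hsum] at key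
  rw [key, h.map_compoundSum_sub (hmono m.le_succ), ht, add_tsub_cancel_left]
  simp only [integral_const_mul]
  rfl

/-- The killed walk observed along an arithmetic progression of times. -/
lemma integral_prod_killWeight (h : IsFairCompound lam N Y P) {t : ℕ → ℝ≥0} {η : ℝ≥0}
    (ht : ∀ i, t (i + 1) = t i + η) (x : ℤ) {a : ℝ} (ha : 0 ≤ a) (ha1 : a ≤ 1) (n : ℕ)
    {f : ℤ → ℝ} (hf : LinearGrowth f) :
    ∫ ω, (if 0 ≤ x + compoundSum N Y (t 0) ω then 1 else 0) *
        ((∏ i ∈ Finset.range n, killWeight a (x + compoundSum N Y (t (i + 1)) ω)) *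
          f (x + compoundSum N Y (t n) ω)) ∂P =
      ∫ ω, (if 0 ≤ x + compoundSum N Y (t 0) ω then 1 else 0) *
        (killedStep (P.map (compoundSum N Y η)) a)^[n] f (x + compoundSum N Y (t 0) ω) ∂P := by
  have := Measure.isProbabilityMeasure_map (h.measurable_compoundSum η).aemeasurable (μ := P)
  induction n generalizing f with
  | zero => simp
  | succ n ih =>
    -- The last observation is peeled off and absorbed into `f`; the remaining factors form a
    -- bounded function `r` of the past.
    rw [Function.iterate_succ_apply, ← ih (linearGrowth_killedStep (h.integrable_id_map η) ha ha1 hf)]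
    let r : (Finset.range (n + 1) → ℤ) → ℝ := fun z =>
      (if 0 ≤ x + z ⟨0, by simp⟩ then 1 else 0) *
        ∏ i : Finset.range n, killWeight a (x + z ⟨i + 1, by
          have := Finset.mem_range.1 i.2; simp; omega⟩)
    have hr : ∀ z, |r z| ≤ 1 := by
      intro z
      have h1 : 0 ≤ ∏ i : Finset.range n, killWeight a (x + z ⟨i + 1, by
          have := Finset.mem_range.1 i.2; simp; omega⟩) :=
        Finset.prod_nonneg fun i _ => killWeight_nonneg ha _
      have h2 : ∏ i : Finset.range n, killWeight a (x + z ⟨i + 1, by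
          have := Finset.mem_range.1 i.2; simp; omega⟩) ≤ 1 :=
        Finset.prod_le_one (fun i _ => killWeight_nonneg ha _) fun i _ => killWeight_le_one ha1 _
      simp only [r]
      split_ifs
      · rwa [one_mul, abs_of_nonneg h1]
      · simp
    have hr' : ∀ ω, r (fun i => compoundSum N Y (t i) ω) =
        (if 0 ≤ x + compoundSum N Y (t 0) ω then 1 else 0) *
        ∏ i ∈ Finset.range n, killWeight a (x + compoundSum N Y (t (i + 1)) ω) := by
      intro ω
      simp only [r]
      rw [Finset.prod_coe_sort (Finset.range n)
        fun i => killWeight a (x + compoundSum N Y (t (i + 1)) ω)]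
    have key := h.integral_killWeight_mul ht x n hr ha ha1 hf
    simp only [hr'] at key
    refine Eq.trans ?_ (key.trans ?_)
    · refine integral_congr_ae (ae_of_all _ fun ω => ?_)
      simp only [Finset.prod_range_succ]
      ring
    · refine integral_congr_ae (ae_of_all _ fun ω => ?_)
      simp only
      ring

/-- The affine function `k ↦ k + c` is harmonic for the killed walk up to second order in the time
step, when the killing and discounting rates balance. -/
lemma abs_killedStep_add_const_sub_le (h : IsFairCompound lam N Y P) {μ c : ℝ} (hμ : 0 ≤ μ)
    (hc : 0 ≤ c) (hc1 : c ≤ 1) (hbal : c * μ = (1 - c) * (lam / 2)) (η : ℝ≥0) {k : ℤ} (hk : 0 ≤ k) :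
    |killedStep (P.map (compoundSum N Y η)) (Real.exp (-(μ * η))) (fun j => (j : ℝ) + c) k -
      ((k : ℝ) + c)| ≤ (μ ^ 2 + μ * lam + 2 * lam ^ 2) * (η : ℝ) ^ 2 := by
  set S := compoundSum N Y η with hS
  set a := Real.exp (-(μ * η)) with ha
  have hx : 0 ≤ μ * η := by positivity
  have ha0 : 0 ≤ a := (Real.exp_pos _).le
  have ha1 : a ≤ 1 := by rw [ha]; simpa using hx
  have hSm : Measurable S := h.measurable_compoundSum η
  have hSi : Integrable (fun ω => (S ω : ℝ)) P := h.integrable_compoundSum η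
  have hlam := lam.coe_nonneg
  have hη := η.coe_nonneg
  -- As the step is centred, the defect equals the mean of `g (k + S)`. Only sites at or below `0`
  -- contribute, with `g 0 = c * (a - 1)` and `g (-1) = 1 - c`.
  let g : ℤ → ℝ := fun i => killWeight a i * ((i : ℝ) + c) - ((i : ℝ) + c)
  have hg0 : g 0 = c * (a - 1) := by simp [g, killWeight]; ring
  have hgpos : ∀ i, 0 < i → g i = 0 := fun i hi => by
    simp [g, killWeight, not_lt.2 hi.le, hi.ne']
  have hgneg : ∀ i, i < 0 → g i = -(i : ℝ) - c := fun i hi => by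
    simp [g, killWeight, hi]; ring
  have hφ := linearGrowth_add_const c
  have hint1 := (hφ.killWeight_mul ha0 ha1).integrable_add hSm hSi k
  have hint2 := hφ.integrable_add hSm hSi k
  have e1 : killedStep (P.map S) a (fun j => (j : ℝ) + c) k - ((k : ℝ) + c) = ∫ ω, g (k + S ω) ∂P := by
    have e2 : ∫ ω, (((k + S ω : ℤ) : ℝ) + c) ∂P = k + c := by
      have : ∀ ω, (((k + S ω : ℤ) : ℝ) + c) = (k + c) + S ω := fun ω => by push_cast; ring
      simp only [this]
      rw [integral_add (integrable_const _) hSi, h.integral_compoundSum]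
      simp
    rw [killedStep, integral_map hSm.aemeasurable Measurable.of_discrete.aestronglyMeasurable, ← e2,
      ← integral_sub hint1 hint2]
  have hgi : Integrable (fun ω => g (k + S ω)) P := hint1.sub hint2
  rw [e1]
  have ha2 := Real.exp_neg_le_one_sub_add_sq hx
  have ha3 := Real.add_one_le_exp (-(μ * η))
  rw [← ha] at ha2 ha3
  have hne := h.measureReal_ne_zero_le η
  have htwo := h.integral_le_neg_two η
  rw [← hS] at hne htwo
  have hmne : MeasurableSet {ω | S ω ≠ 0} := hSm (MeasurableSet.of_discrete (s := {i | i ≠ 0}))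
  have hm1 : MeasurableSet {ω | S ω = -1} := hSm (measurableSet_singleton (-1))
  have hitwo : Integrable (fun ω => if S ω ≤ -2 then -(S ω : ℝ) else 0) P := by
    refine hSi.abs.mono' ((Measurable.of_discrete
      (f := fun i : ℤ => if i ≤ -2 then -(i : ℝ) else 0)).comp hSm).aestronglyMeasurable
      (ae_of_all _ fun ω => ?_)
    split_ifs
    · simp
    · simp
  have hine : Integrable ({ω | S ω ≠ 0}.indicator (1 : Ω → ℝ)) P := (integrable_const _).indicator hmne
  have hi1 : Integrable ({ω | S ω = -1}.indicator (1 : Ω → ℝ)) P := (integrable_const _).indicator hm1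
  rcases hk.eq_or_lt with rfl | hk
  · have hd1 : Integrable (fun ω => c * (a - 1) -
        c * (a - 1) * {ω | S ω ≠ 0}.indicator (1 : Ω → ℝ) ω) P :=
      (integrable_const _).sub (hine.const_mul _)
    have hd2 : Integrable (fun ω => c * (a - 1) -
        c * (a - 1) * {ω | S ω ≠ 0}.indicator (1 : Ω → ℝ) ω +
        (1 - c) * {ω | S ω = -1}.indicator (1 : Ω → ℝ) ω) P := hd1.add (hi1.const_mul _)
    -- Start at `0`: the terms for staying at `0` and for stepping to `-1` are kept; only `S ≤ -2`
    -- is left as an error.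
    have e3 : |∫ ω, g (0 + S ω) ∂P -
        (c * (a - 1) - c * (a - 1) * P.real {ω | S ω ≠ 0} + (1 - c) * P.real {ω | S ω = -1})| ≤
        ∫ ω, (if S ω ≤ -2 then -(S ω : ℝ) else 0) ∂P := by
      rw [← integral_indicator_one hmne, ← integral_indicator_one hm1]
      have e4 : c * (a - 1) - c * (a - 1) * ∫ ω, {ω | S ω ≠ 0}.indicator (1 : Ω → ℝ) ω ∂P +
          (1 - c) * ∫ ω, {ω | S ω = -1}.indicator (1 : Ω → ℝ) ω ∂P =
          ∫ ω, (c * (a - 1) - c * (a - 1) * {ω | S ω ≠ 0}.indicator (1 : Ω → ℝ) ω +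
            (1 - c) * {ω | S ω = -1}.indicator (1 : Ω → ℝ) ω) ∂P := by
        rw [integral_add hd1 (hi1.const_mul _),
          integral_sub (integrable_const _) (hine.const_mul _), integral_const_mul,
          integral_const_mul, integral_const_mul]
        simp
      rw [e4, ← integral_sub hgi hd2]
      refine (abs_integral_le_integral_abs).trans (integral_mono_of_nonneg
        (ae_of_all _ fun _ => abs_nonneg _) hitwo (ae_of_all _ fun ω => ?_))
      simp only [zero_add]
      rcases lt_trichotomy (S ω) 0 with hs | hs | hs
      · rw [hgneg _ hs]
        by_cases hs1 : S ω = -1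
        · simp [hs1]
        · have hs2 : S ω ≤ -2 := by omega
          have hs3 : (S ω : ℝ) ≤ -2 := by exact_mod_cast hs2
          have hi1 : {ω | S ω ≠ 0}.indicator (1 : Ω → ℝ) ω = 1 := Set.indicator_of_mem hs.ne _
          have hi2 : {ω | S ω = -1}.indicator (1 : Ω → ℝ) ω = 0 := 
            Set.indicator_of_notMem (show ω ∉ {ω | S ω = -1} from hs1) _
          rw [hi1, hi2, if_pos hs2, abs_of_nonneg (by linarith)]
          linarith
      · simp [hs, hg0]
      · rw [hgpos _ hs]
        have hs1 : S ω ≠ -1 := by omega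
        have hs2 : ¬ S ω ≤ -2 := by omega
        simp [Set.indicator, hs1, hs2, hs.ne']
    have hm1' := h.abs_measureReal_neg_one_sub_le η
    rw [← hS] at hm1'
    set p := P.real {ω | S ω ≠ 0}
    set p' := P.real {ω | S ω = -1}
    set I := ∫ ω, g (0 + S ω) ∂P
    set J := ∫ ω, (if S ω ≤ -2 then -(S ω : ℝ) else 0) ∂P
    have hp : 0 ≤ p := measureReal_nonneg
    set A := c * (a - 1) - c * (a - 1) * p + (1 - c) * p'
    have hA : |A| ≤ (μ * η) ^ 2 + (μ * η) * (lam * η) + (lam * η) ^ 2 := by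
      -- The first-order terms `-c * μ * η` and `(1 - c) * lam * η / 2` cancel by `hbal`.
      have eA : A = c * (a - 1 + μ * η) + c * ((1 - a) * p) +
          (1 - c) * (p' - lam * η / 2) := by
        simp only [A]; linear_combination (-(η : ℝ)) * hbal
      rw [eA]
      refine (abs_add_three _ _ _).trans (add_le_add (add_le_add ?_ ?_) ?_)
      · rw [abs_of_nonneg (mul_nonneg hc (by linarith))]
        exact (mul_le_of_le_one_left (by linarith) hc1).trans (by linarith)
      · have h1 : 0 ≤ (1 - a) * p := mul_nonneg (by linarith) hp
        rw [abs_of_nonneg (mul_nonneg hc h1)]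
        refine (mul_le_of_le_one_left h1 hc1).trans ?_
        exact mul_le_mul (by linarith) hne hp hx
      · rw [abs_mul, abs_of_nonneg (by linarith : 0 ≤ 1 - c)]
        exact (mul_le_of_le_one_left (abs_nonneg _) (by linarith)).trans hm1'
    have := abs_sub_abs_le_abs_sub I A
    nlinarith
  -- Start above `0`: reaching `0` needs a jump and costs at most `μ * η`, and going below `0` needs
  -- `S ≤ -2`. Both contributions are of second order.
  · have e3 : |∫ ω, g (k + S ω) ∂P| ≤
        ∫ ω, (μ * η * {ω | S ω ≠ 0}.indicator (1 : Ω → ℝ) ω +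
          if S ω ≤ -2 then -(S ω : ℝ) else 0) ∂P := by
      refine (abs_integral_le_integral_abs).trans (integral_mono_of_nonneg
        (ae_of_all _ fun _ => abs_nonneg _) ((hine.const_mul _).add hitwo)
        (ae_of_all _ fun ω => ?_))
      simp only
      have hnn : 0 ≤ μ * η * {ω | S ω ≠ 0}.indicator (1 : Ω → ℝ) ω :=
        mul_nonneg hx (Set.indicator_nonneg (fun _ _ => zero_le_one) _)
      rcases lt_trichotomy (k + S ω) 0 with hs | hs | hs
      · have hs2 : S ω ≤ -2 := by omega
        have hk' : (0 : ℝ) ≤ k := by exact_mod_cast hk.le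
        have hs3 : (k : ℝ) + (S ω : ℝ) ≤ -1 := by exact_mod_cast (by omega : k + S ω ≤ -1)
        rw [hgneg _ hs, if_pos hs2]
        push_cast
        rw [abs_of_nonneg (by linarith)]
        linarith
      · have hs0 : S ω ≠ 0 := by omega
        rw [hs, hg0, abs_mul, abs_of_nonneg hc, abs_of_nonpos (by linarith)]
        have hnn2 : 0 ≤ if S ω ≤ -2 then -(S ω : ℝ) else 0 := by
          split_ifs with hs2
          · have hs3 : (S ω : ℝ) ≤ -2 := by exact_mod_cast hs2
            linarith
          · exact le_rfl
        have : c * -(a - 1) ≤ μ * η :=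
          (mul_le_of_le_one_left (by linarith) hc1).trans (by linarith)
        have hind : {ω | S ω ≠ 0}.indicator (1 : Ω → ℝ) ω = 1 := Set.indicator_of_mem hs0 _
        rw [hind]
        linarith
      · rw [hgpos _ hs, abs_zero]
        have hnn2 : 0 ≤ if S ω ≤ -2 then -(S ω : ℝ) else 0 := by
          split_ifs with hs2
          · have hs3 : (S ω : ℝ) ≤ -2 := by exact_mod_cast hs2
            linarith
          · exact le_rfl
        linarith
    rw [integral_add (hine.const_mul _) hitwo, integral_const_mul, integral_indicator_one hmne] at e3
    have := mul_le_mul_of_nonneg_left hne hx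
    nlinarith

end IsFairCompound

end

/-! ### Grid approximation of functionals of a right-constant path. -/

/-- The path `z` is constant on a right neighbourhood of every time. -/
def IsRightConstant (z : ℝ≥0 → ℤ) : Prop :=
  ∀ t, ∃ ε : ℝ≥0, 0 < ε ∧ ∀ u, t ≤ u → u < t + ε → z u = z t

/-- The `i`-th point of the uniform grid of `[t₁, t₁ + t₂]` with `n + 1` cells. -/
noncomputable def gridPoint (t₁ t₂ : ℝ≥0) (n i : ℕ) : ℝ≥0 := t₁ + i * (t₂ / (n + 1))

lemma gridPoint_zero (t₁ t₂ : ℝ≥0) (n : ℕ) : gridPoint t₁ t₂ n 0 = t₁ := by simp [gridPoint]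

lemma gridPoint_last (t₁ t₂ : ℝ≥0) (n : ℕ) : gridPoint t₁ t₂ n (n + 1) = t₁ + t₂ := by
  have : ((n : ℝ≥0) + 1) ≠ 0 := by positivity
  simp only [gridPoint]
  push_cast
  rw [mul_div_cancel₀ _ this]

lemma gridPoint_succ (t₁ t₂ : ℝ≥0) (n i : ℕ) :
    gridPoint t₁ t₂ n (i + 1) = gridPoint t₁ t₂ n i + t₂ / (n + 1) := by
  simp only [gridPoint]
  push_cast
  ring

lemma gridPoint_mono (t₁ t₂ : ℝ≥0) (n : ℕ) : Monotone (gridPoint t₁ t₂ n) :=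
  monotone_nat_of_le_succ fun i => by rw [gridPoint_succ]; exact le_self_add

lemma eventually_mesh_lt (t₂ : ℝ≥0) {ε : ℝ≥0} (hε : 0 < ε) :
    ∀ᶠ n : ℕ in Filter.atTop, t₂ / (n + 1) < ε := by
  have h : Filter.Tendsto (fun n : ℕ => (t₂ : ℝ) / ((n : ℝ) + 1)) Filter.atTop (nhds 0) :=
    (tendsto_const_div_atTop_nhds_zero_nat (t₂ : ℝ)).comp (Filter.tendsto_add_atTop_nat 1) |>.congr
      fun n => by simp
  filter_upwards [h.eventually (gt_mem_nhds (NNReal.coe_pos.2 hε))] with n hn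
  rw [← NNReal.coe_lt_coe]
  push_cast
  exact hn

/-- Every point of `[t₁, t₁ + t₂)` lies in a cell of the grid. -/
lemma exists_gridPoint_le_lt {t₁ t₂ s : ℝ≥0} (hs : s ∈ Set.Ico t₁ (t₁ + t₂)) (n : ℕ) :
    ∃ i < n + 1, gridPoint t₁ t₂ n i ≤ s ∧ s < gridPoint t₁ t₂ n (i + 1) := by
  classical
  have hex : ∃ i, s < gridPoint t₁ t₂ n i := ⟨n + 1, by rw [gridPoint_last]; exact hs.2⟩
  obtain ⟨j, hj⟩ : ∃ j, Nat.find hex = j + 1 := by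
    refine Nat.exists_eq_succ_of_ne_zero fun h0 => ?_
    have := Nat.find_spec hex
    rw [h0, gridPoint_zero] at this
    exact absurd hs.1 (not_le.2 this)
  refine ⟨j, ?_, not_lt.1 (Nat.find_min hex (by omega)), hj ▸ Nat.find_spec hex⟩
  have : Nat.find hex ≤ n + 1 := Nat.find_min' hex (by rw [gridPoint_last]; exact hs.2)
  omega

/-- The right end point of the cell containing `s` is within one mesh to the right of `s`; this is
why cells are sampled at their right ends. -/
lemma IsRightConstant.eventually_gridPoint_eq {z : ℝ≥0 → ℤ} (hz : IsRightConstant z)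
    (t₁ t₂ s : ℝ≥0) : ∀ᶠ n : ℕ in Filter.atTop, ∀ i, gridPoint t₁ t₂ n i ≤ s →
      s < gridPoint t₁ t₂ n (i + 1) → z (gridPoint t₁ t₂ n (i + 1)) = z s := by
  obtain ⟨ε, hε, h⟩ := hz s
  filter_upwards [eventually_mesh_lt t₂ hε] with n hn i hi hi'
  refine h _ hi'.le ?_
  rw [gridPoint_succ]
  exact add_lt_add_of_le_of_lt hi hn

/-- The number of right end points of grid cells at which the path vanishes. -/
noncomputable def gridZeros (z : ℝ≥0 → ℤ) (t₁ t₂ : ℝ≥0) (n : ℕ) : ℕ :=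
  ((Finset.range (n + 1)).filter fun i => z (gridPoint t₁ t₂ n (i + 1)) = 0).card

/-- The time that the path spends at `0` during `[t₁, t₁ + t₂)`. -/
noncomputable def zeroTime (z : ℝ≥0 → ℤ) (t₁ t₂ : ℝ≥0) : ℝ :=
  (volume {s : ℝ | s ∈ Set.Ico (t₁ : ℝ) ((t₁ : ℝ) + (t₂ : ℝ)) ∧ z s.toNNReal = 0}).toReal

/-- The left side is the measure of the union of the cells whose right end is a zero. These unions
converge pointwise to the zero set inside a window of finite measure. -/
lemma IsRightConstant.tendsto_gridZeros {z : ℝ≥0 → ℤ} (hz : IsRightConstant z) (t₁ t₂ : ℝ≥0) :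
    Filter.Tendsto (fun n : ℕ => ((t₂ / (n + 1) : ℝ≥0) : ℝ) * gridZeros z t₁ t₂ n) Filter.atTop
      (nhds (zeroTime z t₁ t₂)) := by
  let cell : ℕ → ℕ → Set ℝ := fun n i =>
    Set.Ico (gridPoint t₁ t₂ n i : ℝ) (gridPoint t₁ t₂ n (i + 1))
  let A : ℕ → Set ℝ := fun n =>
    ⋃ i ∈ (Finset.range (n + 1)).filter fun i => z (gridPoint t₁ t₂ n (i + 1)) = 0, cell n i
  have hcell : ∀ n i, volume (cell n i) = ((t₂ / (n + 1) : ℝ≥0) : ℝ≥0∞) := by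
    intro n i
    simp only [cell, Real.volume_Ico, gridPoint_succ]
    push_cast
    rw [add_sub_cancel_left]
    rw [← ENNReal.ofReal_coe_nnreal]
    push_cast
    rfl
  have hdisj : ∀ n i j, i < j → Disjoint (cell n i) (cell n j) := by
    intro n i j hij
    rw [Set.disjoint_left]
    intro s h1 h2
    have h3 : (gridPoint t₁ t₂ n (i + 1) : ℝ) ≤ gridPoint t₁ t₂ n j := by
      exact_mod_cast gridPoint_mono t₁ t₂ n hij
    linarith [h1.2, h2.1]
  have hA : ∀ n, volume (A n) = ((t₂ / (n + 1) : ℝ≥0) : ℝ≥0∞) * gridZeros z t₁ t₂ n := by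
    intro n
    rw [measure_biUnion_finset (fun i _ j _ hij => ?_) (fun i _ => measurableSet_Ico)]
    · rw [Finset.sum_congr rfl fun i _ => hcell n i, Finset.sum_const, gridZeros, nsmul_eq_mul,
        mul_comm]
    · rcases lt_or_gt_of_ne hij with h | h
      · exact hdisj n i j h
      · exact (hdisj n j i h).symm
  have hAB : ∀ n, A n ⊆ Set.Ico (t₁ : ℝ) (t₁ + t₂) := by
    intro n s hs
    simp only [A, Set.mem_iUnion] at hs
    obtain ⟨i, hi, hs1, hs2⟩ := hs
    have hi' : i < n + 1 := by simpa using (Finset.mem_filter.1 hi).1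
    have h1 : (gridPoint t₁ t₂ n 0 : ℝ) ≤ gridPoint t₁ t₂ n i := by
      exact_mod_cast gridPoint_mono t₁ t₂ n (Nat.zero_le i)
    have h2 : (gridPoint t₁ t₂ n (i + 1) : ℝ) ≤ gridPoint t₁ t₂ n (n + 1) := by
      exact_mod_cast gridPoint_mono t₁ t₂ n hi'
    rw [gridPoint_zero] at h1
    rw [gridPoint_last] at h2
    push_cast at h2
    exact ⟨by linarith, by linarith⟩
  have hlim := tendsto_measure_of_tendsto_indicator (μ := volume) (L := Filter.atTop)
    (A := {s : ℝ | s ∈ Set.Ico (t₁ : ℝ) ((t₁ : ℝ) + (t₂ : ℝ)) ∧ z s.toNNReal = 0})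
    (As := A) (fun n => Finset.measurableSet_biUnion _ fun i _ => measurableSet_Ico)
    (B := Set.Ico (t₁ : ℝ) (t₁ + t₂)) measurableSet_Ico (by simp) (Filter.Eventually.of_forall hAB)
    (by
      intro s
      by_cases hs : s ∈ Set.Ico (t₁ : ℝ) (t₁ + t₂)
      · have hs0 : 0 ≤ s := t₁.coe_nonneg.trans hs.1
        lift s to ℝ≥0 using hs0
        have hs' : s ∈ Set.Ico t₁ (t₁ + t₂) := ⟨by exact_mod_cast hs.1, by exact_mod_cast hs.2⟩
        filter_upwards [hz.eventually_gridPoint_eq t₁ t₂ s] with n hn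
        simp only [hs, true_and, Real.toNNReal_coe, A, Set.mem_iUnion]
        constructor
        · rintro ⟨i, hi, h1, h2⟩
          rw [← hn i (by exact_mod_cast h1) (by exact_mod_cast h2)]
          exact (Finset.mem_filter.1 hi).2
        · intro h0
          obtain ⟨i, hi, h1, h2⟩ := exists_gridPoint_le_lt hs' n
          refine ⟨i, Finset.mem_filter.2 ⟨Finset.mem_range.2 hi, ?_⟩, ?_, ?_⟩
          · rw [hn i h1 h2, h0]
          · exact_mod_cast h1
          · exact_mod_cast h2
      · refine Filter.Eventually.of_forall fun n => ?_
        simp only [Set.mem_ofPred_eq, hs, false_and, iff_false]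
        exact fun h => hs (hAB n h))
  have hfin : volume {s : ℝ | s ∈ Set.Ico (t₁ : ℝ) ((t₁ : ℝ) + (t₂ : ℝ)) ∧ z s.toNNReal = 0} ≠ ∞ :=
    ne_top_of_le_ne_top (by simp : volume (Set.Ico (t₁ : ℝ) (t₁ + t₂)) ≠ ∞)
      (measure_mono fun s hs => hs.1)
  have := (ENNReal.tendsto_toReal hfin).comp hlim
  refine this.congr fun n => ?_
  rw [Function.comp_apply, hA, ENNReal.toReal_mul, ENNReal.coe_toReal, ENNReal.toReal_natCast]

/-- A negative value at `s` is eventually seen at the right end of its cell. The interval is closed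
because the final time is itself a grid point. -/
lemma IsRightConstant.eventually_grid_nonneg_iff {z : ℝ≥0 → ℤ} (hz : IsRightConstant z)
    (t₁ t₂ : ℝ≥0) : ∀ᶠ n : ℕ in Filter.atTop,
      (0 ≤ z t₁ ∧ ∀ i < n + 1, 0 ≤ z (gridPoint t₁ t₂ n (i + 1))) ↔
        (∀ s ∈ Set.Icc t₁ (t₁ + t₂), 0 ≤ z s) := by
  by_cases h : ∀ s ∈ Set.Icc t₁ (t₁ + t₂), 0 ≤ z s
  · refine Filter.Eventually.of_forall fun n => iff_of_true ⟨h _ ⟨le_rfl, le_self_add⟩, ?_⟩ h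
    intro i hi
    refine h _ ⟨le_self_add, ?_⟩
    rw [← gridPoint_last t₁ t₂ n]
    exact gridPoint_mono _ _ _ hi
  · have h' := h
    push Not at h'
    obtain ⟨s, hs, hzs⟩ := h'
    filter_upwards [hz.eventually_gridPoint_eq t₁ t₂ s] with n hn
    refine iff_of_false (fun h1 => ?_) h
    rcases hs.2.eq_or_lt with rfl | hlt
    · have := h1.2 n n.lt_succ_self
      rw [gridPoint_last] at this
      omega
    · obtain ⟨i, hi, h2, h3⟩ := exists_gridPoint_le_lt ⟨hs.1, hlt⟩ n
      have := h1.2 i hi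
      rw [hn i h2 h3] at this
      omega

lemma prod_killWeight_eq (z : ℝ≥0 → ℤ) (t₁ t₂ : ℝ≥0) (a : ℝ) (n : ℕ) :
    ∏ i ∈ Finset.range (n + 1), killWeight a (z (gridPoint t₁ t₂ n (i + 1))) =
      if ∀ i < n + 1, 0 ≤ z (gridPoint t₁ t₂ n (i + 1)) then a ^ gridZeros z t₁ t₂ n else 0 := by
  split_ifs with h
  · rw [gridZeros, ← Finset.prod_const, Finset.prod_filter]
    refine Finset.prod_congr rfl fun i hi => ?_
    rw [killWeight, if_neg (not_lt.2 (h i (Finset.mem_range.1 hi)))]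
  · push Not at h
    obtain ⟨i, hi, h⟩ := h
    exact Finset.prod_eq_zero (Finset.mem_range.2 hi) (by rw [killWeight, if_pos h])

open Classical in
/-- The discounted survival weight along the grid converges to that of the path. -/
lemma IsRightConstant.tendsto_prod_killWeight {z : ℝ≥0 → ℤ} (hz : IsRightConstant z)
    (t₁ t₂ : ℝ≥0) (μ : ℝ) : Filter.Tendsto (fun n : ℕ => (if 0 ≤ z t₁ then 1 else 0) *
      ∏ i ∈ Finset.range (n + 1), killWeight (Real.exp (-(μ * (t₂ / (n + 1) : ℝ≥0))))
        (z (gridPoint t₁ t₂ n (i + 1)))) Filter.atTop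
      (nhds (if ∀ s ∈ Set.Icc t₁ (t₁ + t₂), 0 ≤ z s then
        Real.exp (-(μ * zeroTime z t₁ t₂)) else 0)) := by
  have h1 : Filter.Tendsto (fun n : ℕ => if ∀ s ∈ Set.Icc t₁ (t₁ + t₂), 0 ≤ z s then
      Real.exp (-(μ * (((t₂ / (n + 1) : ℝ≥0) : ℝ) * gridZeros z t₁ t₂ n))) else 0) Filter.atTop
      (nhds (if ∀ s ∈ Set.Icc t₁ (t₁ + t₂), 0 ≤ z s then
        Real.exp (-(μ * zeroTime z t₁ t₂)) else 0)) := by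
    split_ifs
    · exact (Real.continuous_exp.tendsto _).comp (((hz.tendsto_gridZeros t₁ t₂).const_mul μ).neg)
    · exact tendsto_const_nhds
  refine h1.congr' ?_
  filter_upwards [hz.eventually_grid_nonneg_iff t₁ t₂] with n hn
  rw [prod_killWeight_eq, ← Real.exp_nat_mul]
  simp only [← hn]
  by_cases h2 : 0 ≤ z t₁ <;> by_cases h3 : ∀ i < n + 1, 0 ≤ z (gridPoint t₁ t₂ n (i + 1))
  · rw [if_pos ⟨h2, h3⟩, if_pos h2, if_pos h3, one_mul]
    congr 1
    ring
  · rw [if_neg (fun h => h3 h.2), if_neg h3, mul_zero]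
  · rw [if_neg (fun h => h2 h.1), if_neg h2, zero_mul]
  · rw [if_neg (fun h => h2 h.1), if_neg h2, zero_mul]

lemma zeroTime_nonneg (z : ℝ≥0 → ℤ) (t₁ t₂ : ℝ≥0) : 0 ≤ zeroTime z t₁ t₂ := ENNReal.toReal_nonneg

section

variable {Ω : Type*} {m : MeasurableSpace Ω} {Z : ℝ≥0 → Ω → ℤ}

/-- The σ-algebra is left free: independence from the clock needs measurability with respect to the
one generated by counts and jumps. -/
lemma measurable_zeroTime (hZ : ∀ t, Measurable (Z t)) (hr : ∀ ω, IsRightConstant fun t => Z t ω)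
    (t₁ t₂ : ℝ≥0) : Measurable fun ω => zeroTime (fun t => Z t ω) t₁ t₂ := by
  refine measurable_of_tendsto_metrizable (f := fun n ω => ((t₂ / (n + 1 : ℕ) : ℝ≥0) : ℝ) *
    gridZeros (fun t => Z t ω) t₁ t₂ n) (fun n => ?_) ?_
  · refine measurable_const.mul ((Measurable.of_discrete (f := fun k : ℕ => (k : ℝ))).comp ?_)
    simp only [gridZeros, Finset.card_filter]
    refine Finset.measurable_sum _ fun i _ => ?_
    exact Measurable.ite (hZ _ (measurableSet_singleton 0)) measurable_const measurable_const
  · rw [tendsto_pi_nhds]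
    intro ω
    exact_mod_cast (hr ω).tendsto_gridZeros t₁ t₂

lemma measurableSet_nonneg_on_Icc (hZ : ∀ t, Measurable (Z t))
    (hr : ∀ ω, IsRightConstant fun t => Z t ω) (t₁ t₂ : ℝ≥0) :
    MeasurableSet {ω | ∀ s ∈ Set.Icc t₁ (t₁ + t₂), 0 ≤ Z s ω} := by
  refine measurableSet_of_tendsto_indicator Filter.atTop
    (As := fun n => {ω | 0 ≤ Z t₁ ω ∧ ∀ i < n + 1, 0 ≤ Z (gridPoint t₁ t₂ n (i + 1)) ω})
    (fun n => ?_) fun ω => (hr ω).eventually_grid_nonneg_iff t₁ t₂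
  have h : ∀ t, MeasurableSet {ω | 0 ≤ Z t ω} := fun t =>
    hZ t (MeasurableSet.of_discrete (s := {k | 0 ≤ k}))
  refine (h t₁).inter ?_
  have : {ω | ∀ i < n + 1, 0 ≤ Z (gridPoint t₁ t₂ n (i + 1)) ω} =
      ⋂ i ∈ Finset.range (n + 1), {ω | 0 ≤ Z (gridPoint t₁ t₂ n (i + 1)) ω} := by
    ext ω; simp
  refine MeasurableSet.congr ?_ this.symm
  exact Finset.measurableSet_biInter _ fun i _ => h _

end

/-! ### The exponential clock and the value on the unfilled event. -/

lemma expMeasure_real_Ici {r : ℝ} (hr : 0 < r) {l : ℝ} (hl : 0 ≤ l) :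
    (expMeasure r).real (Set.Ici l) = Real.exp (-(r * l)) := by
  have := isProbabilityMeasure_expMeasure hr
  have hac : expMeasure r ≪ volume := withDensity_absolutelyContinuous _ _
  have h1 : (expMeasure r).real (Set.Iic l) = 1 - Real.exp (-(r * l)) := by
    have := cdf_expMeasure_eq hr l
    rw [if_pos hl] at this
    rw [← this, cdf_eq_real]
  have h2 : (expMeasure r).real (Set.Ici l) = (expMeasure r).real (Set.Iic l)ᶜ := by
    refine measureReal_congr ?_
    rw [Set.compl_Iic]
    exact (Ioi_ae_eq_Ici' (hac (by simp))).symm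
  rw [h2, probReal_compl_eq_one_sub measurableSet_Iic, h1]
  ring

lemma HasLaw.ae_nonneg_of_exp {Ω : Type*} [MeasurableSpace Ω] {P : Measure Ω}
    {r : ℝ} (hr : 0 < r) {e : Ω → ℝ} (he : HasLaw e (expMeasure r) P) : ∀ᵐ ω ∂P, 0 ≤ e ω := by
  have := isProbabilityMeasure_expMeasure hr
  have h := expMeasure_real_Ici hr le_rfl
  rw [mul_zero, neg_zero, Real.exp_zero] at h
  have hm : Measurable fun x : ℝ => 0 ≤ x := measurableSet_setOfPred.1 measurableSet_Ici
  rw [he.ae_iff hm]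
  have h2 : expMeasure r (Set.Ici 0) = 1 := by
    rw [← ENNReal.toReal_eq_one_iff]; exact h
  exact (prob_compl_eq_zero_iff measurableSet_Ici).2 h2

/-- The path of an order's relative price. -/
def pricePath {Ω : Type*} (N : ℝ≥0 → Ω → ℕ) (Y : ℕ → Ω → ℤ) (x : ℤ) (t : ℝ≥0) (ω : Ω) : ℤ :=
  x + compoundSum N Y t ω

/-- The event that an order with clock `e` is not filled during `[t₁, t₁ + t₂)`. -/
def unfilledEvent {Ω : Type*} (N : ℝ≥0 → Ω → ℕ) (Y : ℕ → Ω → ℤ) (e : Ω → ℝ) (t₁ t₂ : ℝ≥0) (x : ℤ) :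
    Set Ω :=
  {ω | (∀ s ∈ Set.Ico t₁ (t₁ + t₂), 0 ≤ pricePath N Y x s ω) ∧
    zeroTime (fun t => pricePath N Y x t ω) t₁ t₂ ≤ e ω}

/-- The expectation of `f` of the final relative price on the event that the order is unfilled. -/
noncomputable def unfilledValue {Ω : Type*} [MeasurableSpace Ω] (P : Measure Ω) (N : ℝ≥0 → Ω → ℕ)
    (Y : ℕ → Ω → ℤ) (e : Ω → ℝ) (t₁ t₂ : ℝ≥0) (f : ℤ → ℝ) (x : ℤ) : ℝ :=
  ∫ ω, (unfilledEvent N Y e t₁ t₂ x).indicator (fun ω => f (pricePath N Y x (t₁ + t₂) ω)) ω ∂P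

/-- Given `m`, the clock survives the level `L` with probability `exp (-r * L)`. -/
lemma integral_indicator_clock_eq {Ω : Type*} {m : MeasurableSpace Ω} [mΩ : MeasurableSpace Ω]
    {P : Measure Ω} [IsProbabilityMeasure P] (hm : m ≤ mΩ) {e : Ω → ℝ}
    (he : Measurable e) {r : ℝ} (hr : 0 < r) (hlaw : HasLaw e (expMeasure r) P)
    (hind : Indep m (MeasurableSpace.comap e inferInstance) P) {G L : Ω → ℝ}
    (hG : Measurable[m] G) (hL : Measurable[m] L) (hL0 : ∀ ω, 0 ≤ L ω) (hint : Integrable G P) :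
    ∫ ω, {ω | L ω ≤ e ω}.indicator G ω ∂P = ∫ ω, G ω * Real.exp (-(r * L ω)) ∂P := by
  have hGL : Measurable[m] fun ω => (G ω, L ω) := hG.prodMk hL
  have hGL' : Measurable fun ω => (G ω, L ω) := hGL.mono hm le_rfl
  have hI : IndepFun (fun ω => (G ω, L ω)) e P :=
    indep_of_indep_of_le_left hind hGL.comap_le
  have hA : MeasurableSet {q : (ℝ × ℝ) × ℝ | q.1.2 ≤ q.2} :=
    measurableSet_le (by fun_prop) (by fun_prop)
  let F : (ℝ × ℝ) × ℝ → ℝ := {q : (ℝ × ℝ) × ℝ | q.1.2 ≤ q.2}.indicator fun q => q.1.1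
  have hF : Measurable F := Measurable.indicator (by fun_prop) hA
  have hFe : ∀ ω, F ((G ω, L ω), e ω) = {ω | L ω ≤ e ω}.indicator G ω := fun ω => by
    rfl
  have key := IndepFun.integral_comp_eq hGL' he hI hF (by
    simp only [hFe]
    exact hint.indicator (hA.preimage (hGL'.prodMk he)))
  simp only [hFe] at key
  rw [key, hlaw.map_eq]
  refine integral_congr_ae (ae_of_all _ fun ω => ?_)
  have h1 : ∀ b, F ((G ω, L ω), b) = (Set.Ici (L ω)).indicator (fun _ => G ω) b := fun b => by
    simp [F, Set.indicator]
  simp only [h1]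
  rw [integral_indicator_const _ measurableSet_Ici, expMeasure_real_Ici hr (hL0 ω), smul_eq_mul,
    mul_comm]

section

set_option linter.unusedSectionVars false

variable {Ω : Type*} [MeasurableSpace Ω] {P : Measure Ω} [IsProbabilityMeasure P]
  {lam : ℝ≥0} {N : ℝ≥0 → Ω → ℕ} {Y : ℕ → Ω → ℤ}

namespace IsFairCompound

lemma isRightConstant_pricePath (h : IsFairCompound lam N Y P) (x : ℤ) (ω : Ω) :
    IsRightConstant fun t => pricePath N Y x t ω := by
  intro t
  have h1 := h.poisson.rightCont ω t
  have h2 : ∀ᶠ u in nhdsWithin t (Set.Ici t), N u ω = N t ω := by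
    have := h1.eventually (p := fun k => k = N t ω) (by simp)
    exact this
  rw [eventually_nhdsWithin_iff, Metric.eventually_nhds_iff] at h2
  obtain ⟨ε, hε, h2⟩ := h2
  refine ⟨⟨ε, hε.le⟩, hε, fun u hu hu' => ?_⟩
  have h3 : N u ω = N t ω := by
    refine h2 ?_ hu
    rw [NNReal.dist_eq, abs_of_nonneg (sub_nonneg.2 (by exact_mod_cast hu))]
    have : (u : ℝ) < t + ε := by exact_mod_cast hu'
    linarith
  simp [pricePath, compoundSum, h3]

lemma measurable_pricePath (h : IsFairCompound lam N Y P) (x : ℤ) (t : ℝ≥0) :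
    Measurable (pricePath N Y x t) :=
  (Measurable.of_discrete (f := fun k => x + k)).comp (h.measurable_compoundSum t)

lemma integrable_pricePath (h : IsFairCompound lam N Y P) {f : ℤ → ℝ} (hf : LinearGrowth f) (x : ℤ)
    (t : ℝ≥0) : Integrable (fun ω => f (pricePath N Y x t ω)) P :=
  hf.integrable_add (h.measurable_compoundSum t) (h.integrable_compoundSum t) x

lemma measurable_pricePath_comap (N : ℝ≥0 → Ω → ℕ) (Y : ℕ → Ω → ℤ) (x : ℤ) (t : ℝ≥0) :
    Measurable[MeasurableSpace.comap
      (fun ω => ((fun t => N t ω, fun i => Y i ω) : (ℝ≥0 → ℕ) × (ℕ → ℤ))) inferInstance]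
      (pricePath N Y x t) :=
  ((Measurable.of_discrete (f := fun k => x + k)).comp (measurable_partialSum_coord t)).comp
    (comap_measurable _)

/-- Almost surely the price does not jump at a given time. -/
lemma ae_nonneg_right_end (h : IsFairCompound lam N Y P) (x : ℤ) (t₁ : ℝ≥0) {t₂ : ℝ≥0}
    (ht₂ : 0 < t₂) : ∀ᵐ ω ∂P, (∀ s ∈ Set.Ico t₁ (t₁ + t₂), 0 ≤ pricePath N Y x s ω) →
      0 ≤ pricePath N Y x (t₁ + t₂) ω := by
  set B := {ω | ¬ ((∀ s ∈ Set.Ico t₁ (t₁ + t₂), 0 ≤ pricePath N Y x s ω) →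
      0 ≤ pricePath N Y x (t₁ + t₂) ω)}
  have hle : ∀ n : ℕ, P.real B ≤ lam * t₂ / (n + 1 : ℕ) := by
    intro n
    -- A violation forces the sum to change over the last `ε` units of time, which has probability
    -- at most `lam * ε`.
    set ε : ℝ≥0 := t₂ / (n + 1 : ℕ)
    have hn : (0 : ℝ≥0) < (n + 1 : ℕ) := by positivity
    have hε : 0 < ε := div_pos ht₂ hn
    have hε2 : ε ≤ t₂ := div_le_self (zero_le) (by exact_mod_cast Nat.le_add_left 1 n)
    set s : ℝ≥0 := t₁ + (t₂ - ε)
    have hs : s + ε = t₁ + t₂ := by rw [add_assoc, tsub_add_cancel_of_le hε2]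
    have hs1 : s < t₁ + t₂ := by rw [← hs]; exact lt_add_of_pos_right _ hε
    have h1 : B ⊆ {ω | compoundSum N Y (t₁ + t₂) ω - compoundSum N Y s ω ∈ ({0}ᶜ : Set ℤ)} := by
      intro ω hω h0
      apply hω
      intro hall
      have h2 := hall s ⟨le_self_add, hs1⟩
      have h3 : compoundSum N Y (t₁ + t₂) ω - compoundSum N Y s ω = 0 := h0
      simp only [pricePath] at h2 ⊢
      omega
    refine (measureReal_mono h1).trans ?_
    have hm : Measurable fun ω => compoundSum N Y (t₁ + t₂) ω - compoundSum N Y s ω :=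
      (h.measurable_compoundSum _).sub (h.measurable_compoundSum _)
    have h4 := h.map_compoundSum_sub hs1.le
    have h5 : t₁ + t₂ - s = ε := by rw [← hs, add_tsub_cancel_left]
    rw [h5] at h4
    have h6 := congrArg (fun ν : Measure ℤ => ν.real {0}ᶜ) h4
    simp only [map_measureReal_apply hm (MeasurableSet.of_discrete (s := ({0}ᶜ : Set ℤ))),
      map_measureReal_apply (h.measurable_compoundSum ε)
        (MeasurableSet.of_discrete (s := ({0}ᶜ : Set ℤ)))] at h6
    refine h6.le.trans ((h.measureReal_ne_zero_le ε).trans (le_of_eq ?_))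
    simp only [ε]
    push_cast
    ring
  have h0 : P.real B ≤ 0 := by
    refine ge_of_tendsto' ((tendsto_const_div_atTop_nhds_zero_nat (lam * t₂ : ℝ)).comp
      (Filter.tendsto_add_atTop_nat 1)) fun n => ?_
    simpa using hle n
  exact (measureReal_eq_zero_iff).1 (le_antisymm h0 measureReal_nonneg)

lemma measurableSet_unfilledEvent_superset (h : IsFairCompound lam N Y P) {e : Ω → ℝ}
    (he : Measurable e) (t₁ t₂ : ℝ≥0) (x : ℤ) :
    MeasurableSet ({ω | ∀ s ∈ Set.Icc t₁ (t₁ + t₂), 0 ≤ pricePath N Y x s ω} ∩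
      {ω | zeroTime (fun t => pricePath N Y x t ω) t₁ t₂ ≤ e ω}) :=
  (measurableSet_nonneg_on_Icc (h.measurable_pricePath x) (h.isRightConstant_pricePath x) t₁ t₂).inter
    (measurableSet_le (measurable_zeroTime (h.measurable_pricePath x) (h.isRightConstant_pricePath x)
      t₁ t₂) he)

/-- Reconciles the half-open window of the model with the closed one seen by the grids. -/
lemma unfilledEvent_ae_eq (h : IsFairCompound lam N Y P) (e : Ω → ℝ) (t₁ : ℝ≥0) {t₂ : ℝ≥0}
    (ht₂ : 0 < t₂) (x : ℤ) : unfilledEvent N Y e t₁ t₂ x =ᵐ[P]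
      ({ω | ∀ s ∈ Set.Icc t₁ (t₁ + t₂), 0 ≤ pricePath N Y x s ω} ∩
        {ω | zeroTime (fun t => pricePath N Y x t ω) t₁ t₂ ≤ e ω} : Set Ω) := by
  filter_upwards [h.ae_nonneg_right_end x t₁ ht₂] with ω hω
  refine propext (and_congr_left' ⟨fun h1 s hs => ?_, fun h1 s hs => h1 s ⟨hs.1, hs.2.le⟩⟩)
  rcases hs.2.eq_or_lt with rfl | hlt
  · exact hω h1
  · exact h1 s ⟨hs.1, hlt⟩

lemma nullMeasurableSet_unfilledEvent (h : IsFairCompound lam N Y P) {e : Ω → ℝ}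
    (he : Measurable e) (t₁ : ℝ≥0) {t₂ : ℝ≥0} (ht₂ : 0 < t₂) (x : ℤ) :
    NullMeasurableSet (unfilledEvent N Y e t₁ t₂ x) P :=
  (h.measurableSet_unfilledEvent_superset he t₁ t₂ x).nullMeasurableSet.congr
    (h.unfilledEvent_ae_eq e t₁ ht₂ x).symm

lemma integrable_unfilled (h : IsFairCompound lam N Y P) {e : Ω → ℝ}
    (he : Measurable e) (t₁ : ℝ≥0) {t₂ : ℝ≥0} (ht₂ : 0 < t₂) {f : ℤ → ℝ} (hf : LinearGrowth f)
    (x : ℤ) : Integrable ((unfilledEvent N Y e t₁ t₂ x).indicator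
      fun ω => f (pricePath N Y x (t₁ + t₂) ω)) P :=
  (h.integrable_pricePath hf x _).indicator₀ (h.nullMeasurableSet_unfilledEvent he t₁ ht₂ x)

-- Averaging over the clock leaves a functional of the price path alone, which the grid products
-- approximate.
open Classical in
lemma unfilledValue_eq_integral_exp (h : IsFairCompound lam N Y P) {e : Ω → ℝ} (he : Measurable e)
    {r : ℝ} (hr : 0 < r) (hlaw : HasLaw e (expMeasure r) P)
    (hind : IndepFun (fun ω => ((fun t => N t ω, fun i => Y i ω) : (ℝ≥0 → ℕ) × (ℕ → ℤ))) e P)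
    (t₁ : ℝ≥0) {t₂ : ℝ≥0} (ht₂ : 0 < t₂) {f : ℤ → ℝ} (hf : LinearGrowth f) (x : ℤ) :
    unfilledValue P N Y e t₁ t₂ f x =
      ∫ ω, (if ∀ s ∈ Set.Icc t₁ (t₁ + t₂), 0 ≤ pricePath N Y x s ω then
        Real.exp (-(r * zeroTime (fun t => pricePath N Y x t ω) t₁ t₂)) else 0) *
        f (pricePath N Y x (t₁ + t₂) ω) ∂P := by
  set A := {ω | ∀ s ∈ Set.Icc t₁ (t₁ + t₂), 0 ≤ pricePath N Y x s ω}
  have hmZ := measurable_pricePath_comap N Y x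
  have hle : MeasurableSpace.comap
      (fun ω => ((fun t => N t ω, fun i => Y i ω) : (ℝ≥0 → ℕ) × (ℕ → ℤ))) inferInstance ≤
      ‹MeasurableSpace Ω› :=
    (h.measurable_count_path.prodMk h.measurable_jump_path).comap_le
  have hA : MeasurableSet[MeasurableSpace.comap
      (fun ω => ((fun t => N t ω, fun i => Y i ω) : (ℝ≥0 → ℕ) × (ℕ → ℤ))) inferInstance] A :=
    measurableSet_nonneg_on_Icc hmZ (h.isRightConstant_pricePath x) t₁ t₂
  have hL := measurable_zeroTime hmZ (h.isRightConstant_pricePath x) t₁ t₂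
  have hG : Measurable[MeasurableSpace.comap
      (fun ω => ((fun t => N t ω, fun i => Y i ω) : (ℝ≥0 → ℕ) × (ℕ → ℤ))) inferInstance]
      (A.indicator fun ω => f (pricePath N Y x (t₁ + t₂) ω)) :=
    Measurable.indicator ((Measurable.of_discrete (f := f)).comp (hmZ _)) hA
  have key := integral_indicator_clock_eq hle he hr hlaw hind hG hL
    (fun ω => zeroTime_nonneg _ _ _) ((h.integrable_pricePath hf x _).indicator (hle _ hA))
  rw [unfilledValue, integral_congr_ae (indicator_ae_eq_of_ae_eq_set
    (h.unfilledEvent_ae_eq e t₁ ht₂ x))]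
  refine Eq.trans ?_ (key.trans ?_)
  · refine integral_congr_ae (ae_of_all _ fun ω => ?_)
    rw [Set.indicator_indicator, Set.inter_comm]
  · refine integral_congr_ae (ae_of_all _ fun ω => ?_)
    by_cases hω : ω ∈ A
    · have hω' : ∀ s ∈ Set.Icc t₁ (t₁ + t₂), 0 ≤ pricePath N Y x s ω := hω
      simp only [Set.indicator_of_mem hω, if_pos hω']
      ring
    · have hω' : ¬ ∀ s ∈ Set.Icc t₁ (t₁ + t₂), 0 ≤ pricePath N Y x s ω := hω
      simp only [Set.indicator_of_notMem hω, if_neg hω']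
      ring

/-- The iterated killed step along the grid with `n + 1` cells, started at `k`. -/
noncomputable def gridValue (P : Measure Ω) (N : ℝ≥0 → Ω → ℕ) (Y : ℕ → Ω → ℤ) (r : ℝ) (t₂ : ℝ≥0)
    (f : ℤ → ℝ) (n : ℕ) (k : ℤ) : ℝ :=
  (if 0 ≤ k then 1 else 0) *
    (killedStep (P.map (compoundSum N Y (t₂ / (n + 1)))) (Real.exp (-(r * (t₂ / (n + 1) : ℝ≥0)))))^[n + 1]
      f k

lemma exp_neg_mesh_le_one {r : ℝ} (hr : 0 < r) (η : ℝ≥0) : Real.exp (-(r * η)) ≤ 1 := by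
  have : 0 ≤ r * η := by positivity
  simpa using this

lemma integral_gridValue (h : IsFairCompound lam N Y P) {r : ℝ} (hr : 0 < r) (t₁ t₂ : ℝ≥0)
    {f : ℤ → ℝ} (hf : LinearGrowth f) (n : ℕ) (x : ℤ) :
    ∫ ω, ((if 0 ≤ pricePath N Y x t₁ ω then 1 else 0) *
      ∏ i ∈ Finset.range (n + 1), killWeight (Real.exp (-(r * (t₂ / (n + 1) : ℝ≥0))))
        (pricePath N Y x (gridPoint t₁ t₂ n (i + 1)) ω)) * f (pricePath N Y x (t₁ + t₂) ω) ∂P =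
      ∫ ω, gridValue P N Y r t₂ f n (pricePath N Y x t₁ ω) ∂P := by
  have := h.integral_prod_killWeight (gridPoint_succ t₁ t₂ n) x
    (Real.exp_pos (-(r * (t₂ / (n + 1) : ℝ≥0)))).le (exp_neg_mesh_le_one hr _) (n + 1) hf
  simp only [gridPoint_zero, gridPoint_last] at this
  simp only [mul_assoc]
  exact this

lemma norm_weighted_le {r : ℝ} (hr : 0 < r) (t₁ t₂ : ℝ≥0) (f : ℤ → ℝ) (n : ℕ) (x : ℤ) (ω : Ω) :
    ‖((if 0 ≤ pricePath N Y x t₁ ω then 1 else 0) *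
      ∏ i ∈ Finset.range (n + 1), killWeight (Real.exp (-(r * (t₂ / (n + 1) : ℝ≥0))))
        (pricePath N Y x (gridPoint t₁ t₂ n (i + 1)) ω)) * f (pricePath N Y x (t₁ + t₂) ω)‖ ≤
      |f (pricePath N Y x (t₁ + t₂) ω)| := by
  rw [norm_mul, Real.norm_eq_abs (f _)]
  refine mul_le_of_le_one_left (abs_nonneg _) ?_
  have h1 := Finset.prod_nonneg (s := Finset.range (n + 1)) fun i _ =>
    killWeight_nonneg (Real.exp_pos (-(r * (t₂ / (n + 1) : ℝ≥0)))).le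
      (pricePath N Y x (gridPoint t₁ t₂ n (i + 1)) ω)
  have h2 := Finset.prod_le_one (s := Finset.range (n + 1)) (fun i _ =>
    killWeight_nonneg (Real.exp_pos (-(r * (t₂ / (n + 1) : ℝ≥0)))).le
      (pricePath N Y x (gridPoint t₁ t₂ n (i + 1)) ω))
    (fun i _ => killWeight_le_one (exp_neg_mesh_le_one hr (t₂ / (n + 1)))
      (pricePath N Y x (gridPoint t₁ t₂ n (i + 1)) ω))
  split_ifs
  · rwa [one_mul, Real.norm_of_nonneg h1]
  · simp

/-- Dominated convergence, with `|f|` of the final price as bound. An arbitrary `t₁` is kept: `t₁ =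
0` gives pointwise convergence of `gridValue`, and the comparison of the two limits is the Markov
property. -/
lemma tendsto_integral_gridValue (h : IsFairCompound lam N Y P) {e : Ω → ℝ} (he : Measurable e)
    {r : ℝ} (hr : 0 < r) (hlaw : HasLaw e (expMeasure r) P)
    (hind : IndepFun (fun ω => ((fun t => N t ω, fun i => Y i ω) : (ℝ≥0 → ℕ) × (ℕ → ℤ))) e P)
    (t₁ : ℝ≥0) {t₂ : ℝ≥0} (ht₂ : 0 < t₂) {f : ℤ → ℝ} (hf : LinearGrowth f) (x : ℤ) :
    Filter.Tendsto (fun n => ∫ ω, gridValue P N Y r t₂ f n (pricePath N Y x t₁ ω) ∂P) Filter.atTop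
      (nhds (unfilledValue P N Y e t₁ t₂ f x)) := by
  classical
  rw [h.unfilledValue_eq_integral_exp he hr hlaw hind t₁ ht₂ hf x]
  simp only [← h.integral_gridValue hr t₁ t₂ hf]
  refine tendsto_integral_of_dominated_convergence
    (fun ω => |f (pricePath N Y x (t₁ + t₂) ω)|) (fun n => ?_)
    (h.integrable_pricePath hf x _).abs (fun n => ae_of_all _ fun ω => ?_)
    (ae_of_all _ fun ω => ?_)
  · refine Measurable.aestronglyMeasurable ?_
    have hd : ∀ (g : ℤ → ℝ) t, Measurable fun ω => g (pricePath N Y x t ω) := fun g t =>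
      (Measurable.of_discrete (f := g)).comp (h.measurable_pricePath x t)
    exact ((hd (fun k => if 0 ≤ k then 1 else 0) t₁).mul
      (Finset.measurable_fun_prod _ fun i _ => hd _ _)).mul (hd f _)
  · exact norm_weighted_le hr t₁ t₂ f n x ω
  · exact ((h.isRightConstant_pricePath x ω).tendsto_prod_killWeight t₁ t₂ r).mul_const _

lemma pricePath_zero (h : IsFairCompound lam N Y P) (x : ℤ) (ω : Ω) : pricePath N Y x 0 ω = x := by
  simp [pricePath, compoundSum, partialSum, h.poisson.start]

lemma tendsto_gridValue (h : IsFairCompound lam N Y P) {e : Ω → ℝ} (he : Measurable e)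
    {r : ℝ} (hr : 0 < r) (hlaw : HasLaw e (expMeasure r) P)
    (hind : IndepFun (fun ω => ((fun t => N t ω, fun i => Y i ω) : (ℝ≥0 → ℕ) × (ℕ → ℤ))) e P)
    {t₂ : ℝ≥0} (ht₂ : 0 < t₂) {f : ℤ → ℝ} (hf : LinearGrowth f) (x : ℤ) :
    Filter.Tendsto (fun n => gridValue P N Y r t₂ f n x) Filter.atTop
      (nhds (unfilledValue P N Y e 0 t₂ f x)) := by
  have := h.tendsto_integral_gridValue he hr hlaw hind 0 ht₂ hf x
  simpa [h.pricePath_zero] using this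

/-- `gridValue` is a mean of `f (k + S)` with weights in `[0, 1]`, so the bound is uniform in the
grid and can serve as a dominating function. -/
lemma exists_abs_gridValue_le (h : IsFairCompound lam N Y P) {r : ℝ} (hr : 0 < r) (t₂ : ℝ≥0)
    {f : ℤ → ℝ} (hf : LinearGrowth f) :
    ∃ C, ∀ n k, |gridValue P N Y r t₂ f n k| ≤ C * (1 + |(k : ℝ)|) := by
  have hf' := hf
  obtain ⟨C, hC, hf⟩ := hf
  set I := ∫ ω, |(compoundSum N Y t₂ ω : ℝ)| ∂P
  have hI : 0 ≤ I := integral_nonneg fun ω => abs_nonneg _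
  refine ⟨C * (1 + I), fun n k => ?_⟩
  have h1 := h.integral_gridValue hr 0 t₂ hf' n k
  simp only [h.pricePath_zero, integral_const, probReal_univ, one_smul] at h1
  rw [← h1]
  have h2 : Integrable (fun ω => |(compoundSum N Y t₂ ω : ℝ)|) P := (h.integrable_compoundSum t₂).abs
  have h3 : ∫ ω, C * (1 + |(k : ℝ)| + |(compoundSum N Y t₂ ω : ℝ)|) ∂P =
      C * (1 + |(k : ℝ)| + I) := by
    rw [integral_const_mul, integral_add (integrable_const _) h2]
    simp [I]
  refine (abs_integral_le_integral_abs).trans ((integral_mono_of_nonneg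
    (ae_of_all _ fun _ => abs_nonneg _) (((integrable_const _).add h2).const_mul C)
    (ae_of_all _ fun ω => ?_)).trans (h3.le.trans ?_))
  · have h4 := norm_weighted_le (N := N) (Y := Y) hr 0 t₂ f n k ω
    simp only [h.pricePath_zero, zero_add] at h4 ⊢
    exact h4.trans (LinearGrowth.abs_add_le hC hf k _)
  · have : 0 ≤ C * (I * |(k : ℝ)|) := by positivity
    nlinarith

lemma linearGrowth_unfilledValue (h : IsFairCompound lam N Y P) {e : Ω → ℝ} (he : Measurable e)
    {r : ℝ} (hr : 0 < r) (hlaw : HasLaw e (expMeasure r) P)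
    (hind : IndepFun (fun ω => ((fun t => N t ω, fun i => Y i ω) : (ℝ≥0 → ℕ) × (ℕ → ℤ))) e P)
    {t₂ : ℝ≥0} (ht₂ : 0 < t₂) {f : ℤ → ℝ} (hf : LinearGrowth f) :
    LinearGrowth (unfilledValue P N Y e 0 t₂ f) := by
  obtain ⟨C, hC⟩ := h.exists_abs_gridValue_le hr t₂ hf
  have h0 : 0 ≤ C := by simpa using (abs_nonneg _).trans (hC 0 0)
  exact ⟨C, h0, fun k => le_of_tendsto' (h.tendsto_gridValue he hr hlaw hind ht₂ hf k).abs
    fun n => hC n k⟩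

/-- The Markov property at the arrival time of the order. -/
lemma unfilledValue_eq_integral (h : IsFairCompound lam N Y P) {e : Ω → ℝ} (he : Measurable e)
    {r : ℝ} (hr : 0 < r) (hlaw : HasLaw e (expMeasure r) P)
    (hind : IndepFun (fun ω => ((fun t => N t ω, fun i => Y i ω) : (ℝ≥0 → ℕ) × (ℕ → ℤ))) e P)
    (t₁ : ℝ≥0) {t₂ : ℝ≥0} (ht₂ : 0 < t₂) {f : ℤ → ℝ} (hf : LinearGrowth f) (x : ℤ) :
    unfilledValue P N Y e t₁ t₂ f x =
      ∫ ω, unfilledValue P N Y e 0 t₂ f (pricePath N Y x t₁ ω) ∂P := by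
  obtain ⟨C, hC⟩ := h.exists_abs_gridValue_le hr t₂ hf
  have h0 : 0 ≤ C := by simpa using (abs_nonneg _).trans (hC 0 0)
  -- Both sides are limits of the same averaged grid values.
  refine tendsto_nhds_unique (h.tendsto_integral_gridValue he hr hlaw hind t₁ ht₂ hf x) ?_
  have hlin : LinearGrowth fun k => C * (1 + |(k : ℝ)|) :=
    ⟨C, h0, fun k => by rw [abs_of_nonneg (by positivity)]⟩
  refine tendsto_integral_of_dominated_convergence _ (fun n => ?_)
    (h.integrable_pricePath hlin x t₁) (fun n => ae_of_all _ fun ω => hC n _)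
    (ae_of_all _ fun ω => h.tendsto_gridValue he hr hlaw hind ht₂ hf _)
  exact ((Measurable.of_discrete (f := gridValue P N Y r t₂ f n)).comp
    (h.measurable_pricePath x t₁)).aestronglyMeasurable

/-- The optional stopping identity for the affine harmonic function. -/
lemma unfilledValue_add_const (h : IsFairCompound lam N Y P) {e : Ω → ℝ} (he : Measurable e)
    {r : ℝ} (hr : 0 < r) (hlaw : HasLaw e (expMeasure r) P)
    (hind : IndepFun (fun ω => ((fun t => N t ω, fun i => Y i ω) : (ℝ≥0 → ℕ) × (ℕ → ℤ))) e P)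
    {t₂ : ℝ≥0} (ht₂ : 0 < t₂) {c : ℝ} (hc : 0 ≤ c) (hc1 : c ≤ 1)
    (hbal : c * r = (1 - c) * (lam / 2)) {x : ℤ} (hx : 0 ≤ x) :
    unfilledValue P N Y e 0 t₂ (fun k => (k : ℝ) + c) x = x + c := by
  have h1 := h.tendsto_gridValue he hr hlaw hind ht₂ (linearGrowth_add_const c) x
  refine tendsto_nhds_unique h1 ?_
  rw [tendsto_iff_dist_tendsto_zero]
  set K := (r ^ 2 + r * lam + 2 * (lam : ℝ) ^ 2)
  have hK : 0 ≤ K := by positivity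
  -- There are `n + 1` steps, each with defect at most `K * (t₂ / (n + 1)) ^ 2`.
  refine squeeze_zero (g := fun n : ℕ => K * (t₂ : ℝ) ^ 2 / (n + 1 : ℕ)) (fun _ => dist_nonneg)
    (fun n => ?_) ((tendsto_const_div_atTop_nhds_zero_nat _).comp (Filter.tendsto_add_atTop_nat 1))
  rw [Real.dist_eq, gridValue, if_pos hx, one_mul]
  have := Measure.isProbabilityMeasure_map
    (h.measurable_compoundSum (t₂ / (n + 1))).aemeasurable (μ := P)
  have h2 := abs_iterate_killedStep_sub_le (h.integrable_id_map (t₂ / (n + 1))) (Real.exp_pos _).le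
    (exp_neg_mesh_le_one hr (t₂ / (n + 1))) (linearGrowth_add_const c) (by positivity)
    (fun k hk => h.abs_killedStep_add_const_sub_le hr.le hc hc1 hbal (t₂ / (n + 1)) hk) (n + 1) hx
  refine h2.trans (le_of_eq ?_)
  have hn : (n : ℝ) + 1 ≠ 0 := by positivity
  push_cast
  simp only [K]
  field_simp

lemma unfilledValue_of_neg (h : IsFairCompound lam N Y P) (e : Ω → ℝ) {t₂ : ℝ≥0} (ht₂ : 0 < t₂)
    (f : ℤ → ℝ) {x : ℤ} (hx : x < 0) : unfilledValue P N Y e 0 t₂ f x = 0 := by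
  have : unfilledEvent N Y e 0 t₂ x = ∅ := by
    rw [Set.eq_empty_iff_forall_notMem]
    intro ω hω
    have := hω.1 0 ⟨le_rfl, by simpa using ht₂⟩
    rw [h.pricePath_zero] at this
    omega
  simp [unfilledValue, this]

end IsFairCompound

end

/-! ### From the market model to the walk seen by one side. -/

lemma ExtInt.ofInt_add (a b : ℤ) : ExtInt.ofInt a + ExtInt.ofInt b = ExtInt.ofInt (a + b) := rfl

lemma ExtInt.ofInt_lt_zero {a : ℤ} : ExtInt.ofInt a < 0 ↔ a < 0 := by
  rw [show (0 : ExtInt) = ExtInt.ofInt 0 from rfl]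
  simp only [ExtInt.ofInt, WithBot.coe_lt_coe, WithTop.coe_lt_coe]

lemma ExtInt.ofInt_eq_zero {a : ℤ} : ExtInt.ofInt a = 0 ↔ a = 0 := by
  rw [show (0 : ExtInt) = ExtInt.ofInt 0 from rfl]
  simp only [ExtInt.ofInt, WithBot.coe_inj, WithTop.coe_inj]

lemma ExtInt.eq_bot_or_top_or_ofInt (δ : ExtInt) : δ = ⊥ ∨ δ = ⊤ ∨ ∃ n, δ = ExtInt.ofInt n := by
  rcases δ with _ | _ | n
  · exact Or.inl rfl
  · exact Or.inr (Or.inl rfl)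
  · exact Or.inr (Or.inr ⟨n, rfl⟩)

/-- The price jumps seen from the side of the order: positive jumps move the quotes away. -/
def sideJump {Ω : Type*} (side : Side) (X : ℕ → Ω → ℤ) (i : ℕ) (ω : Ω) : ℤ := -(side.sgn * X i ω)

lemma Side.sgn_eq (side : Side) : side.sgn = 1 ∨ side.sgn = -1 := by
  cases side
  · exact Or.inl rfl
  · exact Or.inr rfl

section

set_option linter.unusedSectionVars false

variable {Ω : Type*} [MeasurableSpace Ω] {P : Measure Ω} [IsProbabilityMeasure P]
  {lam : ℝ≥0} {hitRate : Side → ℝ≥0} {N : ℝ≥0 → Ω → ℕ} {X : ℕ → Ω → ℤ} {E : Side → Ω → ℝ}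

namespace IsMarketModel

/-- Fair jumps stay fair under a sign change, so ask and bid orders are treated at once. -/
lemma isFairCompound (hM : IsMarketModel lam hitRate N X E P) (side : Side) :
    IsFairCompound lam N (sideJump side X) P where
  poisson := hM.poisson
  measurable_jump i := (Measurable.of_discrete (f := fun k : ℤ => -(side.sgn * k))).comp
    (hM.measurable_jump i)
  jump_up i := by
    rcases side.sgn_eq with h | h
    · refine Eq.trans ?_ (hM.jump_down i)
      congr 1; ext ω; simp only [sideJump, h, Set.mem_ofPred_eq]; omega
    · refine Eq.trans ?_ (hM.jump_up i)
      congr 1; ext ω; simp only [sideJump, h, Set.mem_ofPred_eq]; omega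
  jump_down i := by
    rcases side.sgn_eq with h | h
    · refine Eq.trans ?_ (hM.jump_up i)
      congr 1; ext ω; simp only [sideJump, h, Set.mem_ofPred_eq]; omega
    · refine Eq.trans ?_ (hM.jump_down i)
      congr 1; ext ω; simp only [sideJump, h, Set.mem_ofPred_eq]; omega
  indep_jumps := hM.indep_jumps.comp (fun _ k => -(side.sgn * k)) fun _ => .of_discrete
  indep_count_jumps := hM.indep_count_jumps.comp (φ := id)
    (ψ := fun (y : ℕ → ℤ) i => -(side.sgn * y i)) measurable_id (by fun_prop)

lemma indepFun_clock (hM : IsMarketModel lam hitRate N X E P) (side : Side) :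
    IndepFun (fun ω => ((fun t => N t ω, fun i => sideJump side X i ω) : (ℝ≥0 → ℕ) × (ℕ → ℤ)))
      (E side) P :=
  hM.indep_price_clocks.comp (φ := fun q : (ℝ≥0 → ℕ) × (ℕ → ℤ) => (q.1, fun i => -(side.sgn * q.2 i)))
    (ψ := fun e : Side → ℝ => e side) (by fun_prop) (measurable_pi_apply side)

lemma neg_sgn_mul_priceChange (N : ℝ≥0 → Ω → ℕ) (X : ℕ → Ω → ℤ) (p₀ : ℤ) (side : Side)
    (x : ℤ) (a b : ℝ≥0) (ω : Ω) :
    -(side.sgn * priceChange (midPrice p₀ N X) a b ω) =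
      pricePath N (sideJump side X) x b ω - pricePath N (sideJump side X) x a ω := by
  simp only [priceChange, midPrice, pricePath, compoundSum, partialSum, sideJump,
    Finset.sum_neg_distrib, ← Finset.mul_sum]
  ring

lemma relPrice_ofInt (hM : IsMarketModel lam hitRate N X E P) (p₀ : ℤ) (side : Side)
    (x : ℤ) (s : ℝ≥0) (ω : Ω) :
    relPrice (midPrice p₀ N X) side (ExtInt.ofInt x) s ω =
      ExtInt.ofInt (pricePath N (sideJump side X) x s ω) := by
  rw [relPrice, neg_sgn_mul_priceChange N X p₀ side x, (hM.isFairCompound side).pricePath_zero,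
    ExtInt.ofInt_add]
  congr 1
  ring

/-- Immediate execution is the case `s = t₁` of a negative relative price in the window, which
contains `t₁` because `t₂ > 0`. -/
lemma fillEvent_ofInt (hM : IsMarketModel lam hitRate N X E P) (p₀ : ℤ) (side : Side)
    (t₁ : ℝ≥0) {t₂ : ℝ≥0} (ht₂ : 0 < t₂) (x : ℤ) :
    fillEvent (midPrice p₀ N X) E side t₁ t₂ (ExtInt.ofInt x) =
      (unfilledEvent N (sideJump side X) (E side) t₁ t₂ x)ᶜ := by
  ext ω
  simp only [fillEvent, Filled, hM.relPrice_ofInt, ExtInt.ofInt_lt_zero, ExtInt.ofInt_eq_zero,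
    unfilledEvent, Set.mem_compl_iff, Set.mem_ofPred_eq, not_and_or, not_le, not_forall, zeroTime]
  constructor
  · rintro (h | ⟨s, hs, h⟩ | h)
    · exact Or.inl ⟨t₁, ⟨le_rfl, lt_add_of_pos_right _ ht₂⟩, h⟩
    · exact Or.inl ⟨s, hs, h⟩
    · exact Or.inr h
  · rintro (⟨s, hs, h⟩ | h)
    · exact Or.inr (Or.inl ⟨s, hs, h⟩)
    · exact Or.inr (Or.inr h)

end IsMarketModel

/-! ### Order values at integer relative prices. -/

/-- The execution gap `max {1/2 + k, -1/2}` at an integer relative price. -/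
noncomputable def integerGap (k : ℤ) : ℝ := max (1 / 2 + (k : ℝ)) (-(1 / 2))

lemma linearGrowth_integerGap : LinearGrowth integerGap := by
  refine ⟨1, zero_le_one, fun k => ?_⟩
  have := neg_abs_le (k : ℝ)
  have := le_abs_self (k : ℝ)
  rw [one_mul, abs_le, integerGap]
  exact ⟨le_max_of_le_right (by linarith [abs_nonneg (k : ℝ)]),
    max_le (by linarith) (by linarith [abs_nonneg (k : ℝ)])⟩

lemma integerGap_of_nonneg {k : ℤ} (hk : 0 ≤ k) : integerGap k = k + 1 / 2 := by
  have : (0 : ℝ) ≤ k := by exact_mod_cast hk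
  rw [integerGap, max_eq_left (by linarith)]
  ring

lemma integerGap_of_neg {k : ℤ} (hk : k < 0) : integerGap k = -(1 / 2) := by
  have : (k : ℝ) ≤ -1 := by exact_mod_cast Int.le_sub_one_of_lt hk
  rw [integerGap, max_eq_right (by linarith)]

namespace IsMarketModel

/-- On the unfilled event the price at arrival is nonnegative, so gap plus increment is the final
price plus `1/2`, and the right side vanishes there. -/
lemma orderProfit_ofInt (hM : IsMarketModel lam hitRate N X E P) (p₀ : ℤ) (side : Side)
    (t₁ : ℝ≥0) {t₂ : ℝ≥0} (ht₂ : 0 < t₂) (x : ℤ) (ω : Ω) :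
    orderProfit (midPrice p₀ N X) E side t₁ t₂ (ExtInt.ofInt x) ω =
      integerGap (pricePath N (sideJump side X) x t₁ ω) +
        ((pricePath N (sideJump side X) x (t₁ + t₂) ω : ℝ) - pricePath N (sideJump side X) x t₁ ω) -
      (unfilledEvent N (sideJump side X) (E side) t₁ t₂ x).indicator
        (fun ω => (pricePath N (sideJump side X) x (t₁ + t₂) ω : ℝ) + 1 / 2) ω := by
  have hgap : ∀ k, executionGap (ExtInt.ofInt k) = integerGap k := fun k => rfl
  have hd := congrArg (Int.cast : ℤ → ℝ) (neg_sgn_mul_priceChange N X p₀ side x t₁ (t₁ + t₂) ω)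
  rw [Int.cast_neg, Int.cast_sub] at hd
  rw [orderProfit, hM.fillEvent_ofInt p₀ side t₁ ht₂ x]
  by_cases hω : ω ∈ unfilledEvent N (sideJump side X) (E side) t₁ t₂ x
  · rw [Set.indicator_of_notMem (by simpa using hω), Set.indicator_of_mem hω,
      integerGap_of_nonneg (hω.1 t₁ ⟨le_rfl, lt_add_of_pos_right _ ht₂⟩)]
    ring
  · rw [Set.indicator_of_mem (by simpa using hω), Set.indicator_of_notMem hω, hM.relPrice_ofInt,
      hgap]
    linarith

lemma integrable_pricePath (hM : IsMarketModel lam hitRate N X E P) (side : Side) {f : ℤ → ℝ}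
    (hf : LinearGrowth f) (x : ℤ) (t : ℝ≥0) :
    Integrable (fun ω => f (pricePath N (sideJump side X) x t ω)) P :=
  (hM.isFairCompound side).integrable_pricePath hf x t

lemma linearGrowth_cast : LinearGrowth fun k => (k : ℝ) := by
  simpa using linearGrowth_add_const 0

lemma integral_pricePath (hM : IsMarketModel lam hitRate N X E P) (side : Side) (x : ℤ) (t : ℝ≥0) :
    ∫ ω, (pricePath N (sideJump side X) x t ω : ℝ) ∂P = x := by
  simp only [pricePath, Int.cast_add]
  rw [integral_add (integrable_const _) ((hM.isFairCompound side).integrable_compoundSum t),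
    (hM.isFairCompound side).integral_compoundSum]
  simp

lemma integrable_orderProfit_ofInt (hM : IsMarketModel lam hitRate N X E P) (p₀ : ℤ) (side : Side)
    (t₁ : ℝ≥0) {t₂ : ℝ≥0} (ht₂ : 0 < t₂) (x : ℤ) :
    Integrable (orderProfit (midPrice p₀ N X) E side t₁ t₂ (ExtInt.ofInt x)) P := by
  rw [funext (hM.orderProfit_ofInt p₀ side t₁ ht₂ x)]
  exact ((hM.integrable_pricePath side linearGrowth_integerGap x t₁).add
    ((hM.integrable_pricePath side linearGrowth_cast x _).sub
      (hM.integrable_pricePath side linearGrowth_cast x _))).sub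
    ((hM.isFairCompound side).integrable_unfilled (hM.measurable_clock side) t₁ ht₂
      (linearGrowth_add_const (1 / 2)) x)

lemma orderValue_ofInt (hM : IsMarketModel lam hitRate N X E P) (p₀ : ℤ) (side : Side)
    (t₁ : ℝ≥0) {t₂ : ℝ≥0} (ht₂ : 0 < t₂) (x : ℤ) :
    orderValue (midPrice p₀ N X) E P side t₁ t₂ (ExtInt.ofInt x) =
      ∫ ω, integerGap (pricePath N (sideJump side X) x t₁ ω) ∂P -
      unfilledValue P N (sideJump side X) (E side) t₁ t₂ (fun k => (k : ℝ) + 1 / 2) x := by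
  have h1 := hM.integrable_pricePath side linearGrowth_integerGap x t₁
  have h2 := fun t => hM.integrable_pricePath side linearGrowth_cast x t
  have h3 := (hM.isFairCompound side).integrable_unfilled (hM.measurable_clock side) t₁ ht₂
      (linearGrowth_add_const (1 / 2)) x
  have h4 : Integrable (fun ω => (pricePath N (sideJump side X) x (t₁ + t₂) ω : ℝ) -
    pricePath N (sideJump side X) x t₁ ω) P := (h2 _).sub (h2 _)
  have h5 : Integrable (fun ω => integerGap (pricePath N (sideJump side X) x t₁ ω) +
    ((pricePath N (sideJump side X) x (t₁ + t₂) ω : ℝ) - pricePath N (sideJump side X) x t₁ ω)) P :=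
    h1.add h4
  rw [orderValue, funext (hM.orderProfit_ofInt p₀ side t₁ ht₂ x), integral_sub h5 h3,
    integral_add h1 h4, integral_sub (h2 _) (h2 _), hM.integral_pricePath, hM.integral_pricePath]
  simp [unfilledValue]

lemma nullMeasurableSet_fillEvent_ofInt (hM : IsMarketModel lam hitRate N X E P) (p₀ : ℤ)
    (side : Side) (t₁ : ℝ≥0) {t₂ : ℝ≥0} (ht₂ : 0 < t₂) (x : ℤ) :
    NullMeasurableSet (fillEvent (midPrice p₀ N X) E side t₁ t₂ (ExtInt.ofInt x)) P := by
  rw [hM.fillEvent_ofInt p₀ side t₁ ht₂ x]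
  exact ((hM.isFairCompound side).nullMeasurableSet_unfilledEvent (hM.measurable_clock side) t₁ ht₂
    x).compl

lemma fillProb_eq_measureReal (hM : IsMarketModel lam hitRate N X E P) (p₀ : ℤ)
    (side : Side) (t₁ : ℝ≥0) {t₂ : ℝ≥0} (ht₂ : 0 < t₂) (x : ℤ) :
    fillProb (midPrice p₀ N X) E P side t₁ t₂ (ExtInt.ofInt x) =
      P.real (fillEvent (midPrice p₀ N X) E side t₁ t₂ (ExtInt.ofInt x)) := by
  rw [fillProb, integral_indicator₀ (hM.nullMeasurableSet_fillEvent_ofInt p₀ side t₁ ht₂ x)]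
  simp

lemma fillProb_ofInt (hM : IsMarketModel lam hitRate N X E P) (p₀ : ℤ)
    (side : Side) (t₁ : ℝ≥0) {t₂ : ℝ≥0} (ht₂ : 0 < t₂) (x : ℤ) :
    fillProb (midPrice p₀ N X) E P side t₁ t₂ (ExtInt.ofInt x) =
      1 - unfilledValue P N (sideJump side X) (E side) t₁ t₂ (fun _ => 1) x := by
  have h3 := (hM.isFairCompound side).integrable_unfilled (hM.measurable_clock side) t₁ ht₂
      (linearGrowth_const 1) x
  have h4 : (1 : ℝ) = ∫ _, (1 : ℝ) ∂P := by simp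
  rw [unfilledValue, show ∀ y : ℝ, 1 - y = ∫ _, (1 : ℝ) ∂P - y from fun y => by rw [← h4],
    ← integral_sub (integrable_const _) h3, fillProb, hM.fillEvent_ofInt p₀ side t₁ ht₂ x]
  refine integral_congr_ae (ae_of_all _ fun ω => ?_)
  by_cases hω : ω ∈ unfilledEvent N (sideJump side X) (E side) t₁ t₂ x <;> simp [hω]

lemma orderValue_zero_of_nonneg (hM : IsMarketModel lam hitRate N X E P) (p₀ : ℤ)
    (side : Side) (hhit : 0 < hitRate side) {t₂ : ℝ≥0} (ht₂ : 0 < t₂) {x : ℤ} (hx : 0 ≤ x) :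
    orderValue (midPrice p₀ N X) E P side 0 t₂ (ExtInt.ofInt x) =
      ((hitRate side : ℝ) / ((hitRate side : ℝ) + (lam : ℝ) / 2) - 1 / 2) *
        fillProb (midPrice p₀ N X) E P side 0 t₂ (ExtInt.ofInt x) := by
  have hF := hM.isFairCompound side
  have hr : (0 : ℝ) < hitRate side := by exact_mod_cast hhit
  have hl := lam.coe_nonneg
  set r : ℝ := (hitRate side : ℝ)
  -- The constant that makes `k + c` harmonic for the killed walk.
  set c : ℝ := (lam / 2) / (r + lam / 2)
  have hc1 : r / (r + lam / 2) = 1 - c := by simp only [c]; field_simp; ring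
  have hbal : c * r = (1 - c) * (lam / 2) := by rw [← hc1]; simp only [c]; field_simp
  have hc0 : 0 ≤ c := by positivity
  have hcle : c ≤ 1 := by
    have : 0 ≤ r / (r + lam / 2) := by positivity
    linarith
  have key := hF.unfilledValue_add_const (hM.measurable_clock side) hr (hM.law_clock side)
    (hM.indepFun_clock side) ht₂ hc0 hcle hbal hx
  have h1 := hF.integrable_unfilled (hM.measurable_clock side) 0 ht₂ (linearGrowth_add_const c) x
  have h2 := hF.integrable_unfilled (hM.measurable_clock side) 0 ht₂ (linearGrowth_const 1) x
  have hsplit : unfilledValue P N (sideJump side X) (E side) 0 t₂ (fun k => (k : ℝ) + 1 / 2) x =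
      unfilledValue P N (sideJump side X) (E side) 0 t₂ (fun k => (k : ℝ) + c) x +
      (1 / 2 - c) * unfilledValue P N (sideJump side X) (E side) 0 t₂ (fun _ => 1) x := by
    simp only [unfilledValue]
    rw [← integral_const_mul, ← integral_add h1 (h2.const_mul _)]
    refine integral_congr_ae (ae_of_all _ fun ω => ?_)
    by_cases hω : ω ∈ unfilledEvent N (sideJump side X) (E side) 0 t₂ x
    · simp only [Set.indicator_of_mem hω]; ring
    · simp only [Set.indicator_of_notMem hω]; ring
  rw [hM.orderValue_ofInt p₀ side 0 ht₂, hM.fillProb_ofInt p₀ side 0 ht₂, hsplit, key, hc1]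
  simp only [hF.pricePath_zero, integral_const, probReal_univ, one_smul]
  rw [integerGap_of_nonneg hx]
  ring

lemma orderValue_zero_of_neg (hM : IsMarketModel lam hitRate N X E P) (p₀ : ℤ)
    (side : Side) {t₂ : ℝ≥0} (ht₂ : 0 < t₂) {x : ℤ} (hx : x < 0) :
    orderValue (midPrice p₀ N X) E P side 0 t₂ (ExtInt.ofInt x) = -(1 / 2) := by
  have hF := hM.isFairCompound side
  rw [hM.orderValue_ofInt p₀ side 0 ht₂, hF.unfilledValue_of_neg _ ht₂ _ hx]
  simp only [hF.pricePath_zero, integral_const, probReal_univ, one_smul]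
  rw [integerGap_of_neg hx, sub_zero]

lemma orderValue_zero_eq (hM : IsMarketModel lam hitRate N X E P) (p₀ : ℤ)
    (side : Side) {t₂ : ℝ≥0} (ht₂ : 0 < t₂) (x : ℤ) :
    orderValue (midPrice p₀ N X) E P side 0 t₂ (ExtInt.ofInt x) = integerGap x -
      unfilledValue P N (sideJump side X) (E side) 0 t₂ (fun k => (k : ℝ) + 1 / 2) x := by
  rw [hM.orderValue_ofInt p₀ side 0 ht₂]
  simp [(hM.isFairCompound side).pricePath_zero]

lemma linearGrowth_orderValue_zero (hM : IsMarketModel lam hitRate N X E P) (p₀ : ℤ)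
    (side : Side) (hhit : 0 < hitRate side) {t₂ : ℝ≥0} (ht₂ : 0 < t₂) :
    LinearGrowth fun k => orderValue (midPrice p₀ N X) E P side 0 t₂ (ExtInt.ofInt k) := by
  obtain ⟨C, hC, h1⟩ := linearGrowth_integerGap
  obtain ⟨D, hD, h2⟩ := (hM.isFairCompound side).linearGrowth_unfilledValue
    (hM.measurable_clock side) (by exact_mod_cast hhit) (hM.law_clock side)
    (hM.indepFun_clock side) ht₂ (linearGrowth_add_const (1 / 2))
  refine ⟨C + D, by positivity, fun k => ?_⟩
  simp only [hM.orderValue_zero_eq p₀ side ht₂, add_mul]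
  exact (abs_sub _ _).trans (add_le_add (h1 k) (h2 k))

/-- The value of an order is the mean value of the order as seen on its arrival. -/
lemma orderValue_ofInt_eq_integral (hM : IsMarketModel lam hitRate N X E P) (p₀ : ℤ)
    (side : Side) (hhit : 0 < hitRate side) (t₁ : ℝ≥0) {t₂ : ℝ≥0} (ht₂ : 0 < t₂) (x : ℤ) :
    orderValue (midPrice p₀ N X) E P side t₁ t₂ (ExtInt.ofInt x) =
      ∫ ω, orderValue (midPrice p₀ N X) E P side 0 t₂
        (ExtInt.ofInt (pricePath N (sideJump side X) x t₁ ω)) ∂P := by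
  have hF := hM.isFairCompound side
  have hr : (0 : ℝ) < hitRate side := by exact_mod_cast hhit
  have hφ := linearGrowth_add_const (1 / 2)
  simp only [hM.orderValue_zero_eq p₀ side ht₂]
  rw [hM.orderValue_ofInt p₀ side t₁ ht₂, integral_sub
    (hM.integrable_pricePath side linearGrowth_integerGap x t₁)
    (hM.integrable_pricePath side (hF.linearGrowth_unfilledValue (hM.measurable_clock side) hr
      (hM.law_clock side) (hM.indepFun_clock side) ht₂ hφ) x t₁),
    hF.unfilledValue_eq_integral (hM.measurable_clock side) hr (hM.law_clock side)
      (hM.indepFun_clock side) t₁ ht₂ hφ]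

/-- A negative price at `t₂ / 2`, strictly inside the half-open window, already fills the order. -/
lemma fillProb_pos (hM : IsMarketModel lam hitRate N X E P) (hlam : 0 < lam) (p₀ : ℤ)
    (side : Side) {t₂ : ℝ≥0} (ht₂ : 0 < t₂) :
    0 < fillProb (midPrice p₀ N X) E P side 0 t₂ (ExtInt.ofInt 0) := by
  have hF := hM.isFairCompound side
  rw [hM.fillProb_eq_measureReal p₀ side 0 ht₂]
  refine (hF.measureReal_neg_pos hlam (half_pos ht₂)).trans_le (measureReal_mono fun ω hω => ?_)
  rw [hM.fillEvent_ofInt p₀ side 0 ht₂]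
  intro h
  have h1 := h.1 (t₂ / 2) ⟨zero_le, by rw [zero_add]; exact half_lt_self ht₂⟩
  have h2 : compoundSum N (sideJump side X) (t₂ / 2) ω < 0 := hω
  simp only [pricePath] at h1
  omega

/-! ### Orders at infinite relative prices. -/

lemma relPrice_top (p₀ : ℤ) (side : Side) (s : ℝ≥0) (ω : Ω) :
    relPrice (midPrice p₀ N X) side ⊤ s ω = ⊤ := rfl

lemma relPrice_bot (p₀ : ℤ) (side : Side) (s : ℝ≥0) (ω : Ω) :
    relPrice (midPrice p₀ N X) side ⊥ s ω = ⊥ := rfl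

/-- No time is spent at the best quote, so a fill would need a negative clock; this is excluded only
almost surely. -/
lemma fillEvent_top (hM : IsMarketModel lam hitRate N X E P) (p₀ : ℤ) (side : Side)
    (hhit : 0 < hitRate side) (t₁ t₂ : ℝ≥0) :
    fillEvent (midPrice p₀ N X) E side t₁ t₂ ⊤ =ᵐ[P] (∅ : Set Ω) := by
  filter_upwards [HasLaw.ae_nonneg_of_exp (by exact_mod_cast hhit) (hM.law_clock side)] with ω hω
  refine propext (iff_of_false ?_ (fun h => h))
  have h1 : ¬ (⊤ : ExtInt) < 0 := not_top_lt
  have h2 : (⊤ : ExtInt) ≠ 0 := fun h => by cases h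
  change ¬ Filled _ _ _ _ _ _ _
  simp only [Filled, relPrice_top, h1, h2]
  simpa using hω

lemma orderProfit_top (hM : IsMarketModel lam hitRate N X E P) (p₀ : ℤ) (side : Side)
    (hhit : 0 < hitRate side) (t₁ t₂ : ℝ≥0) :
    orderProfit (midPrice p₀ N X) E side t₁ t₂ ⊤ =ᵐ[P] 0 :=
  (indicator_ae_eq_of_ae_eq_set (hM.fillEvent_top p₀ side hhit t₁ t₂)).trans
    (by rw [Set.indicator_empty]; rfl)

lemma orderValue_top (hM : IsMarketModel lam hitRate N X E P) (p₀ : ℤ) (side : Side)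
    (hhit : 0 < hitRate side) (t₁ t₂ : ℝ≥0) :
    orderValue (midPrice p₀ N X) E P side t₁ t₂ ⊤ = 0 := by
  rw [orderValue, integral_congr_ae (hM.orderProfit_top p₀ side hhit t₁ t₂)]
  simp

lemma fillProb_top (hM : IsMarketModel lam hitRate N X E P) (p₀ : ℤ) (side : Side)
    (hhit : 0 < hitRate side) (t₁ t₂ : ℝ≥0) :
    fillProb (midPrice p₀ N X) E P side t₁ t₂ ⊤ = 0 := by
  rw [fillProb, integral_congr_ae (indicator_ae_eq_of_ae_eq_set
    (hM.fillEvent_top p₀ side hhit t₁ t₂))]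
  simp

lemma fillEvent_bot (p₀ : ℤ) (side : Side) (t₁ t₂ : ℝ≥0) :
    fillEvent (midPrice p₀ N X) E side t₁ t₂ ⊥ = Set.univ := by
  refine Set.eq_univ_of_forall fun ω => Or.inl ?_
  rw [relPrice_bot]
  exact WithBot.bot_lt_coe _

/-- The starting point `0` of the path is arbitrary, since only an increment occurs. -/
lemma orderProfit_bot (N : ℝ≥0 → Ω → ℕ) (X : ℕ → Ω → ℤ) (E : Side → Ω → ℝ) (p₀ : ℤ) (side : Side)
    (t₁ t₂ : ℝ≥0) (ω : Ω) :
    orderProfit (midPrice p₀ N X) E side t₁ t₂ ⊥ ω = -(1 / 2) +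
      ((pricePath N (sideJump side X) 0 (t₁ + t₂) ω : ℝ) - pricePath N (sideJump side X) 0 t₁ ω) := by
  have hd := congrArg (Int.cast : ℤ → ℝ) (neg_sgn_mul_priceChange N X p₀ side 0 t₁ (t₁ + t₂) ω)
  rw [Int.cast_neg, Int.cast_sub] at hd
  rw [orderProfit, fillEvent_bot, Set.indicator_univ, relPrice_bot, ← hd]
  rfl

lemma integrable_orderProfit_bot (hM : IsMarketModel lam hitRate N X E P) (p₀ : ℤ) (side : Side)
    (t₁ t₂ : ℝ≥0) : Integrable (orderProfit (midPrice p₀ N X) E side t₁ t₂ ⊥) P := by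
  rw [funext (orderProfit_bot N X E p₀ side t₁ t₂)]
  exact (integrable_const _).add ((hM.integrable_pricePath side linearGrowth_cast 0 _).sub
    (hM.integrable_pricePath side linearGrowth_cast 0 _))

lemma orderValue_bot (hM : IsMarketModel lam hitRate N X E P) (p₀ : ℤ) (side : Side)
    (t₁ t₂ : ℝ≥0) : orderValue (midPrice p₀ N X) E P side t₁ t₂ ⊥ = -(1 / 2) := by
  have h2 := fun t => hM.integrable_pricePath side linearGrowth_cast 0 t
  have h3 : Integrable (fun ω => (pricePath N (sideJump side X) 0 (t₁ + t₂) ω : ℝ) -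
    pricePath N (sideJump side X) 0 t₁ ω) P := (h2 _).sub (h2 _)
  rw [orderValue, funext (orderProfit_bot N X E p₀ side t₁ t₂),
    integral_add (integrable_const _) h3, integral_sub (h2 _) (h2 _),
    hM.integral_pricePath, hM.integral_pricePath]
  simp

/-! ### Part (c) and the final assembly. -/

/-- If the clock beats the adverse price jumps, some order has a positive value. -/
lemma exists_orderValue_pos (hM : IsMarketModel lam hitRate N X E P) (hlam : 0 < lam) (p₀ : ℤ)
    (side : Side) (t₁ : ℝ≥0) {t₂ : ℝ≥0} (ht₂ : 0 < t₂)
    (hrate : (lam : ℝ) / 2 < hitRate side) :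
    ∃ n : ℕ, 0 < orderValue (midPrice p₀ N X) E P side t₁ t₂ (ExtInt.ofInt n) := by
  by_contra! hcon
  have hF := hM.isFairCompound side
  have hl : (0 : ℝ) < lam := by exact_mod_cast hlam
  have hhit : 0 < hitRate side := by
    have : (0 : ℝ) < hitRate side := by linarith
    exact_mod_cast this
  set q : ℝ := (hitRate side : ℝ) / ((hitRate side : ℝ) + (lam : ℝ) / 2) with hqdef
  have hq : 1 / 2 < q := by
    rw [hqdef, lt_div_iff₀ (by positivity)]
    linarith
  set H : ℤ → ℝ := fun k => orderValue (midPrice p₀ N X) E P side 0 t₂ (ExtInt.ofInt k) with hH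
  set c := H 0
  have hc : 0 < c := by
    simp only [c, hH, hM.orderValue_zero_of_nonneg p₀ side hhit ht₂ le_rfl]
    exact mul_pos (by linarith) (hM.fillProb_pos hlam p₀ side ht₂)
  have hHnonneg : ∀ k, 0 ≤ k → 0 ≤ H k := fun k hk => by
    simp only [hH, hM.orderValue_zero_of_nonneg p₀ side hhit ht₂ hk]
    refine mul_nonneg (by linarith) ?_
    rw [hM.fillProb_eq_measureReal p₀ side 0 ht₂]
    exact measureReal_nonneg
  have hHneg : ∀ k, k < 0 → H k = -(1 / 2) := fun k hk => hM.orderValue_zero_of_neg p₀ side ht₂ hk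
  set S := compoundSum N (sideJump side X) t₁
  have hS : Measurable S := hF.measurable_compoundSum t₁
  set g : ℕ → ℝ := fun n => P.real {ω | S ω ≤ -n}
  have hmeas : ∀ n : ℕ, MeasurableSet {ω | S ω ≤ -n} := fun n =>
    hS (MeasurableSet.of_discrete (s := {k : ℤ | k ≤ -n}))
  have hind : ∀ n : ℕ, Integrable ({ω | S ω ≤ -n}.indicator (1 : Ω → ℝ)) P := fun n =>
    (integrable_const _).indicator (hmeas n)
  -- `H` equals `-1/2` below `0`, equals `c` at `0` and is nonnegative above. The value of order `n`
  -- is thus at least `c * (g n - g (n + 1)) - g (n + 1) / 2`, while `hcon` makes it nonpositive.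
  have hstep : ∀ n : ℕ, c * g n ≤ (c + 1 / 2) * g (n + 1) := by
    intro n
    have h1 := hcon n
    rw [hM.orderValue_ofInt_eq_integral p₀ side hhit t₁ ht₂] at h1
    have h2 : ∫ ω, (c * {ω | S ω ≤ -n}.indicator (1 : Ω → ℝ) ω -
        (c + 1 / 2) * {ω | S ω ≤ -(n + 1 : ℕ)}.indicator (1 : Ω → ℝ) ω) ∂P ≤
        ∫ ω, H (pricePath N (sideJump side X) n t₁ ω) ∂P := by
      refine integral_mono (((hind n).const_mul c).sub ((hind (n + 1)).const_mul _))
        (hM.integrable_pricePath side (hM.linearGrowth_orderValue_zero p₀ side hhit ht₂) n t₁)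
        fun ω => ?_
      have hp : pricePath N (sideJump side X) n t₁ ω = n + S ω := rfl
      simp only [hp]
      rcases lt_trichotomy ((n : ℤ) + S ω) 0 with h | h | h
      · have e1 : ω ∈ {ω | S ω ≤ -n} := show S ω ≤ -n by omega
        have e2 : ω ∈ {ω | S ω ≤ -(n + 1 : ℕ)} :=
          show S ω ≤ -(n + 1 : ℕ) by push_cast; omega
        rw [Set.indicator_of_mem e1, Set.indicator_of_mem e2, hHneg _ h]
        simp only [Pi.one_apply]
        linarith
      · have e1 : ω ∈ {ω | S ω ≤ -n} := show S ω ≤ -n by omega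
        have e2 : ω ∉ {ω | S ω ≤ -(n + 1 : ℕ)} :=
          show ¬ S ω ≤ -(n + 1 : ℕ) by push_cast; omega
        rw [Set.indicator_of_mem e1, Set.indicator_of_notMem e2, h]
        simp only [Pi.one_apply]
        linarith
      · have e1 : ω ∉ {ω | S ω ≤ -n} := show ¬ S ω ≤ -n by omega
        have e2 : ω ∉ {ω | S ω ≤ -(n + 1 : ℕ)} :=
          show ¬ S ω ≤ -(n + 1 : ℕ) by push_cast; omega
        rw [Set.indicator_of_notMem e1, Set.indicator_of_notMem e2]
        linarith [hHnonneg _ h.le]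
    rw [integral_sub ((hind n).const_mul c) ((hind (n + 1)).const_mul _), integral_const_mul,
      integral_const_mul, integral_indicator_one (hmeas n),
      integral_indicator_one (hmeas (n + 1))] at h2
    linarith
  set K : ℝ := (c + 1 / 2) / c
  have hK : 1 ≤ K := by rw [le_div_iff₀ hc]; linarith
  have hgK : ∀ n, g 0 ≤ K ^ n * g n := by
    intro n
    induction n with
    | zero => simp
    | succ n ih =>
      refine ih.trans ?_
      have : g n ≤ K * g (n + 1) := by
        rw [div_mul_eq_mul_div, le_div_iff₀ hc, mul_comm]
        exact hstep n
      rw [pow_succ, mul_assoc]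
      exact mul_le_mul_of_nonneg_left this (by positivity)
  -- The base `2 * K` beats the geometric lower bound `hgK` by the factor `2 ^ n`, which is
  -- unbounded.
  obtain ⟨M, hM'⟩ := hF.exists_tail_bound t₁ (by linarith : 1 ≤ 2 * K)
  have hg0 : 0 < g 0 := by
    have := hF.measureReal_nonpos_pos t₁
    simpa [g, S] using this
  have hb : ∀ n : ℕ, (2 : ℝ) ^ n * g 0 ≤ M := fun n => by
    refine le_trans ?_ (hM' n)
    rw [mul_pow, mul_assoc]
    exact mul_le_mul_of_nonneg_left (hgK n) (by positivity)
  obtain ⟨n, hn⟩ := pow_unbounded_of_one_lt (M / g 0) (one_lt_two (α := ℝ))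
  rw [div_lt_iff₀ hg0] at hn
  exact absurd (hb n) (not_le.2 hn)

end IsMarketModel

end

theorem theorem1 {Ω : Type*} [MeasurableSpace Ω] (P : Measure Ω) [IsProbabilityMeasure P]
    (lam : ℝ≥0) (hlam : 0 < lam) (hitRate : Side → ℝ≥0) (hhit : ∀ side, 0 < hitRate side)
    (p₀ : ℤ) (N : ℝ≥0 → Ω → ℕ) (X : ℕ → Ω → ℤ) (E : Side → Ω → ℝ)
    (hM : IsMarketModel lam hitRate N X E P)
    (side : Side) (t₁ t₂ : ℝ≥0) (ht₂ : 0 < t₂) :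
    -- the expectations in the definition of the order value and of the fill probability exist
    (∀ δ : ExtInt,
      NullMeasurableSet (fillEvent (midPrice p₀ N X) E side t₁ t₂ δ) P ∧
      Integrable (orderProfit (midPrice p₀ N X) E side t₁ t₂ δ) P) ∧
    -- (a)
    (∀ δ : ExtInt,
      (0 ≤ δ → orderValue (midPrice p₀ N X) E P side 0 t₂ δ =
        ((hitRate side : ℝ) / ((hitRate side : ℝ) + (lam : ℝ) / 2) - 1 / 2) *
          fillProb (midPrice p₀ N X) E P side 0 t₂ δ) ∧
      (δ < 0 → orderValue (midPrice p₀ N X) E P side 0 t₂ δ = -(1 / 2))) ∧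
    -- (b)
    (∀ δ : ExtInt,
      Integrable (fun ω => orderValue (midPrice p₀ N X) E P side 0 t₂
        (relPrice (midPrice p₀ N X) side δ t₁ ω)) P ∧
      orderValue (midPrice p₀ N X) E P side t₁ t₂ δ =
        ∫ ω, orderValue (midPrice p₀ N X) E P side 0 t₂
          (relPrice (midPrice p₀ N X) side δ t₁ ω) ∂P) ∧
    -- (c)
    ((∀ δ : ExtInt, orderValue (midPrice p₀ N X) E P side t₁ t₂ δ ≤ 0) ↔
      (hitRate side : ℝ) ≤ (lam : ℝ) / 2) := by
  have hr : (0 : ℝ) < hitRate side := by exact_mod_cast hhit side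
  have hl : (0 : ℝ) < lam := by exact_mod_cast hlam
  have hb : ∀ δ : ExtInt,
      Integrable (fun ω => orderValue (midPrice p₀ N X) E P side 0 t₂
        (relPrice (midPrice p₀ N X) side δ t₁ ω)) P ∧
      orderValue (midPrice p₀ N X) E P side t₁ t₂ δ =
        ∫ ω, orderValue (midPrice p₀ N X) E P side 0 t₂
          (relPrice (midPrice p₀ N X) side δ t₁ ω) ∂P := by
    intro δ
    rcases δ.eq_bot_or_top_or_ofInt with rfl | rfl | ⟨x, rfl⟩
    · simp only [IsMarketModel.relPrice_bot, hM.orderValue_bot]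
      exact ⟨integrable_const _, by simp⟩
    · simp only [IsMarketModel.relPrice_top, hM.orderValue_top p₀ side (hhit side)]
      exact ⟨integrable_const _, by simp⟩
    · simp only [hM.relPrice_ofInt]
      exact ⟨hM.integrable_pricePath side
        (hM.linearGrowth_orderValue_zero p₀ side (hhit side) ht₂) x t₁,
        hM.orderValue_ofInt_eq_integral p₀ side (hhit side) t₁ ht₂ x⟩
  refine ⟨fun δ => ?_, fun δ => ⟨fun hδ => ?_, fun hδ => ?_⟩, hb, fun hall => ?_, fun hrate δ => ?_⟩
  · rcases δ.eq_bot_or_top_or_ofInt with rfl | rfl | ⟨x, rfl⟩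
    · rw [IsMarketModel.fillEvent_bot]
      exact ⟨nullMeasurableSet_univ, hM.integrable_orderProfit_bot p₀ side t₁ t₂⟩
    · exact ⟨nullMeasurableSet_empty.congr (hM.fillEvent_top p₀ side (hhit side) t₁ t₂).symm,
        (integrable_zero _ _ _).congr (hM.orderProfit_top p₀ side (hhit side) t₁ t₂).symm⟩
    · exact ⟨hM.nullMeasurableSet_fillEvent_ofInt p₀ side t₁ ht₂ x,
        hM.integrable_orderProfit_ofInt p₀ side t₁ ht₂ x⟩
  · rcases δ.eq_bot_or_top_or_ofInt with rfl | rfl | ⟨x, rfl⟩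
    · exact absurd hδ (not_le.2 (WithBot.bot_lt_coe _))
    · rw [hM.orderValue_top p₀ side (hhit side), hM.fillProb_top p₀ side (hhit side), mul_zero]
    · exact hM.orderValue_zero_of_nonneg p₀ side (hhit side) ht₂
        (not_lt.1 fun h => absurd hδ (not_le.2 (ExtInt.ofInt_lt_zero.2 h)))
  · rcases δ.eq_bot_or_top_or_ofInt with rfl | rfl | ⟨x, rfl⟩
    · exact hM.orderValue_bot p₀ side 0 t₂
    · exact absurd hδ not_top_lt
    · exact hM.orderValue_zero_of_neg p₀ side ht₂ (ExtInt.ofInt_lt_zero.1 hδ)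
  · by_contra! hrate
    obtain ⟨n, hn⟩ := hM.exists_orderValue_pos hlam p₀ side t₁ ht₂ hrate
    exact absurd (hall _) (not_le.2 hn)
  · rcases δ.eq_bot_or_top_or_ofInt with rfl | rfl | ⟨x, rfl⟩
    · rw [hM.orderValue_bot]; norm_num
    · rw [hM.orderValue_top p₀ side (hhit side)]
    -- By (b) it suffices that every value on arrival is nonpositive, which (a) shows when the
    -- coefficient of the fill probability is.
    · rw [hM.orderValue_ofInt_eq_integral p₀ side (hhit side) t₁ ht₂]
      refine integral_nonpos fun ω => ?_
      simp only [Pi.zero_apply]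
      rcases lt_or_ge (pricePath N (sideJump side X) x t₁ ω) 0 with hk | hk
      · rw [hM.orderValue_zero_of_neg p₀ side ht₂ hk]; norm_num
      · rw [hM.orderValue_zero_of_nonneg p₀ side (hhit side) ht₂ hk,
          hM.fillProb_eq_measureReal p₀ side 0 ht₂]
        refine mul_nonpos_of_nonpos_of_nonneg ?_ measureReal_nonneg
        rw [sub_nonpos, div_le_iff₀ (by positivity)]
        linarith
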